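/- Let $\lambda$ be a partition, identified with its Young diagram (boxes $(i,j)$, $i$ the row counted from the top, $j$ the column counted from the left), and let $x_{i,j}$, $(i,j)\in\lambda$, be independent variables. For $(a,b)\in\lambda$ let $\lambda_{a,b}$ be the set of boxes $(i,j)\in\lambda$ with $i\ge a$, $j\ge b$, and let $$p_{a,b}(x)=\sum_{\mu\subset\lambda_{a,b}}\ \prod_{(r,s)\in\lambda_{a,b}\setminus\mu}x_{r,s}$$ be the Bessenrodt–Stanley polynomial, the sum being over all sub-diagrams (sub-partitions) $\mu$ of $\lambda_{a,b}$. Let $\lambda^{(1)}=\lambda$ and let $\lambda^{(i+1)}$ be $\lambda^{(i)}$ with its first row and first column removed. For $m\ge1$ and $(a,b)\in\lambda^{(m)}$ (equivalently, the $m\times m$ square of boxes with North-West corner $(a,b)$ is contained in $\lambda$) put $$p_{a,b,m}(x)=\det\big(p_{a+i-1,b+j-1}(x)\big)_{1\le i,j\le m}.$$ The network $\mathcal N_{a,b}$ is the directed graph whose vertices are the corners of the boxes of $\lambda_{a,b}$ and whose edges are the sides of these boxes, oriented North or East. Put $Z_{c,d}=\prod_{r\ge0,\,(c+r,d+r)\in\lambda}\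 \prod_{(i,j)\in\lambda_{c+r,d+r}}x_{i,j}$ (so $Z_{c,d}=1$ if $(c,d)\notin\lambda$), and for a vertex $v$ that is the North-West corner of the (possibly virtual) box $(r,s)$ put $Z(v)=Z_{r,s}$ and $Z'(v)=Z_{r+1,s+1}$. The weight of an East edge $u\to v$ is $Z(u)/Z(v)$, the weight of a North edge $u\to v$ is $Z'(u)/Z'(v)$, and the weight of a path is the product of the weights of its edges. For $1\le i\le m$ let $\ell_i$ be the lower end of the left side of column $b+i-1$ of $\lambda$, and $r_i$ the right end of the top side of row $a+i-1$ of $\lambda$ (the left and right projections of the vertices of the square). Then: 1. $p_{a,b,m}(x)$ has non-negative integer coefficients. 2. $p_{a,b,m}(x)$ is the partition function of $m$ non-intersecting paths on $\mathcal N_{a,b}$: it is the sum, over all families $(P_1,\dots,P_m)$ of pairwise vertex-disjoint directed paths with $P_i$ going from $\ell_i$ to $r_i$, of the product of the weights of $P_1,\dots,P_m$. 3. $p_{a,b,m}(x)$ is the partition function of $m$ strictly nested partitions inside $\lambda_{a,b}$: $$p_{a,b,m}(x)=\sum_{(\mu_1,\dots,\mu_m)}\ \prod_{i=1}^m\ \prod_{(\alpha,\beta)\in\lambda_{a,b}\setminus\mu_i}x_{\alpha,\beta},$$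 where the sum is over all families of sub-diagrams $\mu_i$ of $\lambda_{a,b}$ such that $\lambda_{a,b}\setminus\mu_m\subset\cdots\subset\lambda_{a,b}\setminus\mu_1\subset\lambda_{a,b}$, such that $\lambda_{a,b}\setminus\mu_i\subset\lambda_{a,b}^{(i)}$, where $\lambda_{a,b}^{(i)}=\lambda_{a+i-1,b+i-1}$ is $\lambda_{a,b}$ without its first $i-1$ rows and columns, and such that the nesting is strict: for $1\le i<m$ and every box $(r,s)\in\mu_i\cap\lambda_{a,b}^{(i)}$, the box $(r+1,s+1)$ belongs to $\mu_{i+1}$ (the boundary lines of $\mu_i$ and $\mu_{i+1}$ have no point in common). -/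

import Mathlib

/-! Young diagrams are Mathlib's `YoungDiagram`s. Rows and columns are numbered from `0`, so that the
box `(i, j)` here is the box in row `i + 1` and column `j + 1` of the usual numbering. -/

noncomputable section

/-- The sub-diagram `λ_{a,b}`: the boxes of `λ` that are weakly South-East of `(a, b)`. -/
def subRegion (lam : YoungDiagram) (a b : ℕ) : Finset (ℕ × ℕ) :=
  lam.cells.filter fun c => a ≤ c.1 ∧ b ≤ c.2

/-- `μ` is a sub-diagram (sub-partition) of the diagram with set of boxes `S`: it is closed under
moving North or West inside `S`. -/
def IsSubdiagram (S μ : Finset (ℕ × ℕ)) : Prop :=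
  μ ⊆ S ∧ ∀ c ∈ μ, ∀ d ∈ S, d.1 ≤ c.1 → d.2 ≤ c.2 → d ∈ μ

open Classical in
/-- The finite set of all sub-diagrams of `S`. -/
def subdiagrams (S : Finset (ℕ × ℕ)) : Finset (Finset (ℕ × ℕ)) :=
  S.powerset.filter fun μ => IsSubdiagram S μ

/-- The product of the variables `x_{i,j}` over a finite set of boxes. -/
def boxProd (S : Finset (ℕ × ℕ)) : MvPolynomial (ℕ × ℕ) ℤ :=
  ∏ c ∈ S, MvPolynomial.X c

/-- The Bessenrodt-Stanley polynomial `p_{a,b}(x)`. If `(a, b)` is not a box of `λ`, then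
`λ_{a,b}` is empty and the value is `1`. -/
def bsPoly (lam : YoungDiagram) (a b : ℕ) : MvPolynomial (ℕ × ℕ) ℤ :=
  ∑ μ ∈ subdiagrams (subRegion lam a b), boxProd (subRegion lam a b \ μ)

/-- The pyramid polynomial `p_{a,b,m}(x)`: the `m × m` minor with North-West corner `(a, b)`. -/
def pyramidPoly (lam : YoungDiagram) (a b m : ℕ) : MvPolynomial (ℕ × ℕ) ℤ :=
  Matrix.det (Matrix.of fun i j : Fin m => bsPoly lam (a + i) (b + j))

/-- The diagram obtained by removing the first row and the first column. -/
def removeFirst (lam : YoungDiagram) : YoungDiagram where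
  cells := lam.cells.filter fun c => (c.1 + 1, c.2 + 1) ∈ lam
  isLowerSet := by
    rintro ⟨i, j⟩ ⟨i', j'⟩ h hc
    have h' : i' ≤ i ∧ j' ≤ j := h
    simp only [Finset.coe_filter, Set.mem_ofPred_eq, YoungDiagram.mem_cells] at hc ⊢
    exact ⟨lam.up_left_mem h'.1 h'.2 hc.1,
      lam.up_left_mem (Nat.succ_le_succ h'.1) (Nat.succ_le_succ h'.2) hc.2⟩

/-- The `m`-th layer `λ^{(m)}` (`m ≥ 1`) of the pyramid of `λ`: `λ^{(1)} = λ`, and `λ^{(m+1)}` is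
`λ^{(m)}` without its first row and first column. -/
def pyramidLayer (lam : YoungDiagram) (m : ℕ) : YoungDiagram :=
  removeFirst^[m - 1] lam

/-! ### The network

The vertices of the network `N_{a,b}` are the corners of the boxes of `λ_{a,b}`. The corner `(r, s)`
is the lattice point with `r` rows above it and `s` columns to its left, that is, the North-West
corner of the box `(r, s)`. The network is drawn with the box `(a, b)` on top, so an edge that is
oriented from left to right goes either North (a step up) or East (a step down). -/

/-- The oriented edges of the network of the diagram `S`: the four sides of every box of `S`. -/
def IsNetEdge (S : Finset (ℕ × ℕ)) (u v : ℕ × ℕ) : Prop :=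
  ∃ c ∈ S,
    (u = (c.1 + 1, c.2) ∧ v = (c.1, c.2)) ∨
    (u = (c.1 + 1, c.2 + 1) ∧ v = (c.1, c.2 + 1)) ∨
    (u = (c.1, c.2) ∧ v = (c.1, c.2 + 1)) ∨
    (u = (c.1 + 1, c.2) ∧ v = (c.1 + 1, c.2 + 1))

/-- An oriented path from `u` to `v`, as the list of its vertices. -/
def IsNetPath (S : Finset (ℕ × ℕ)) (u v : ℕ × ℕ) (l : List (ℕ × ℕ)) : Prop :=
  l.IsChain (IsNetEdge S) ∧ l.head? = some u ∧ l.getLast? = some v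

/-- The value `Z_{a,b}` of the parameter `θ_{a,b}`, namely `∏_r ∏_{λ_{a+r,b+r}} x`. Boxes
`(a + r, b + r)` outside `λ` would only contribute empty products, so `r` is restricted to the boxes
of `λ` on the diagonal that starts at `(a, b)`. The value is `1` outside `λ`. -/
def thetaZ (lam : YoungDiagram) (c : ℕ × ℕ) : MvPolynomial (ℕ × ℕ) ℤ :=
  ∏ d ∈ lam.cells.filter (fun d => c.1 ≤ d.1 ∧ c.2 ≤ d.2 ∧ d.1 - c.1 = d.2 - c.2),
    boxProd (subRegion lam d.1 d.2)

/-- The field of rational functions in the variables `x_{i,j}`. -/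
abbrev BoxRatFun : Type := FractionRing (MvPolynomial (ℕ × ℕ) ℤ)

/-- The variable on the face just above the vertex `v`. The face variables are the `θ`s displaced
by one row up and one column to the left, so the face whose South-East corner is `(r, s)` carries
`θ_{r,s}`. -/
def faceAbove (lam : YoungDiagram) (v : ℕ × ℕ) : BoxRatFun :=
  algebraMap (MvPolynomial (ℕ × ℕ) ℤ) BoxRatFun (thetaZ lam v)

/-- The variable on the face just below the vertex `v`, i.e. the face whose North-West corner
is `v`. It is `1` on the faces outside the diagram. -/
def faceBelow (lam : YoungDiagram) (v : ℕ × ℕ) : BoxRatFun :=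
  algebraMap (MvPolynomial (ℕ × ℕ) ℤ) BoxRatFun (thetaZ lam (v.1 + 1, v.2 + 1))

/-- The weight of the edge from `u` to `v`: the ratio of the variables of the faces below `u` and
below `v` for a step up, and of the faces above `u` and above `v` for a step down. -/
def edgeWeight (lam : YoungDiagram) (u v : ℕ × ℕ) : BoxRatFun :=
  if v.1 < u.1 then faceBelow lam u / faceBelow lam v else faceAbove lam u / faceAbove lam v

/-- The weight of a path: the product of the weights of its edges. -/
def pathWeight (lam : YoungDiagram) (l : List (ℕ × ℕ)) : BoxRatFun :=
  ((l.zip l.tail).map fun e => edgeWeight lam e.1 e.2).prod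

/-- The left projection of a vertex: down its column line to the boundary of `λ`. -/
def leftProj (lam : YoungDiagram) (v : ℕ × ℕ) : ℕ × ℕ := (lam.colLen v.2, v.2)

/-- The right projection of a vertex: along its row line to the boundary of `λ`. -/
def rightProj (lam : YoungDiagram) (v : ℕ × ℕ) : ℕ × ℕ := (v.1, lam.rowLen v.1)

/-- The families of `m` non-intersecting (vertex-disjoint) paths on `N_{a,b}`; the `i`-th path goes
from the `i`-th left projection to the `i`-th right projection of the top vertices of the boxes of
the square of size `m` with North-West corner `(a, b)`. (The left projection depends only on the
column and the right one only on the row, so the diagonal of the square gives all of them.) -/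
def nonIntersecting (lam : YoungDiagram) (a b m : ℕ) : Set (Fin m → List (ℕ × ℕ)) :=
  {P | (∀ i : Fin m, IsNetPath (subRegion lam a b)
          (leftProj lam (a + i, b + i)) (rightProj lam (a + i, b + i)) (P i)) ∧
       ∀ i j : Fin m, i ≠ j → List.Disjoint (P i) (P j)}

/-- There are finitely many paths between two given vertices. -/
theorem finite_isNetPath (S : Finset (ℕ × ℕ)) (u v : ℕ × ℕ) :
    {l : List (ℕ × ℕ) | IsNetPath S u v l}.Finite := by
  classical
  have hlt : ∀ p q, IsNetEdge S p q → (p.2 : ℤ) - p.1 < (q.2 : ℤ) - q.1 := by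
    rintro p q ⟨c, -, h⟩
    rcases h with ⟨rfl, rfl⟩ | ⟨rfl, rfl⟩ | ⟨rfl, rfl⟩ | ⟨rfl, rfl⟩ <;> push_cast <;> linarith
  let V : Finset (ℕ × ℕ) := insert u (S.biUnion fun c =>
    {(c.1, c.2), (c.1 + 1, c.2), (c.1, c.2 + 1), (c.1 + 1, c.2 + 1)})
  have hV : ∀ p q, IsNetEdge S p q → q ∈ V := by
    rintro p q ⟨c, hc, h⟩
    refine Finset.mem_insert_of_mem (Finset.mem_biUnion.2 ⟨c, hc, ?_⟩)
    rcases h with ⟨-, rfl⟩ | ⟨-, rfl⟩ | ⟨-, rfl⟩ | ⟨-, rfl⟩ <;> simp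
  have hmem : ∀ (l : List (ℕ × ℕ)) (w : ℕ × ℕ), w ∈ V → (w :: l).IsChain (IsNetEdge S) →
      ∀ z ∈ w :: l, z ∈ V := by
    intro l
    induction l with
    | nil => intro w hw _ z hz; simp at hz; exact hz ▸ hw
    | cons y l ih =>
      intro w hw h z hz
      rw [List.isChain_cons_cons] at h
      rcases List.mem_cons.1 hz with rfl | hz
      · exact hw
      · exact ih y (hV _ _ h.1) h.2 z hz
  refine ((List.finite_length_le V V.card).image (List.map Subtype.val)).subset ?_
  rintro l ⟨hc, hh, -⟩
  obtain ⟨t, rfl⟩ : ∃ t, l = u :: t := by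
    cases l with
    | nil => simp at hh
    | cons y t => simp at hh; exact ⟨t, by rw [hh]⟩
  have hin := hmem t u (Finset.mem_insert_self _ _) hc
  have hnd : (u :: t).Nodup := by
    have h1 : ((u :: t).map fun p : ℕ × ℕ => (p.2 : ℤ) - p.1).IsChain (· < ·) := by
      rw [List.isChain_map]
      exact hc.imp fun p q h => hlt p q h
    exact List.Nodup.of_map _ (h1.pairwise.imp fun h => ne_of_lt h)
  refine ⟨(u :: t).attach.map fun z => ⟨z.1, hin z.1 z.2⟩, ?_, ?_⟩
  · simp only [Set.mem_ofPred_eq, List.length_map, List.length_attach]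
    rw [← List.toFinset_card_of_nodup hnd]
    exact Finset.card_le_card fun z hz => hin z (List.mem_toFinset.1 hz)
  · rw [List.map_map]
    exact List.attach_map_subtype_val (u :: t)

theorem finite_nonIntersecting (lam : YoungDiagram) (a b m : ℕ) :
    (nonIntersecting lam a b m).Finite :=
  (Set.Finite.pi' fun i : Fin m => finite_isNetPath (subRegion lam a b)
    (leftProj lam (a + i, b + i)) (rightProj lam (a + i, b + i))).subset fun _ hP => hP.1

/-- The partition function of `m` non-intersecting paths on the network `N_{a,b}`. -/
def pathPartition (lam : YoungDiagram) (a b m : ℕ) : BoxRatFun :=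
  ∑ P ∈ (finite_nonIntersecting lam a b m).toFinset, ∏ i, pathWeight lam (P i)

/-! ### Strictly nested partitions -/

/-- Strictly nested sub-diagrams `μ_0, …, μ_{m-1}` of `λ_{a,b}`. The parts `λ_{a,b} \ μ_i` below
their boundary lines form a decreasing chain, and `λ_{a,b} \ μ_i` lies in the diagram
`λ_{a+i,b+i}` obtained from `λ_{a,b}` by removing its first `i` rows and columns. Strictness means
that the boundary line of `μ_{i+1}` stays strictly below the boundary line of `μ_i` (the two have no
lattice point in common): the box diagonally below a box of `μ_i` is in `μ_{i+1}`. -/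
def IsStrictlyNested (lam : YoungDiagram) (a b m : ℕ) (μ : Fin m → Finset (ℕ × ℕ)) : Prop :=
  (∀ i : Fin m, IsSubdiagram (subRegion lam a b) (μ i)) ∧
  (∀ i : Fin m, subRegion lam a b \ μ i ⊆ subRegion lam (a + i) (b + i)) ∧
  (∀ i j : Fin m, (i : ℕ) + 1 = j →
    subRegion lam a b \ μ j ⊆ subRegion lam a b \ μ i ∧
    ∀ c ∈ μ i, c ∈ subRegion lam (a + i) (b + i) → (c.1 + 1, c.2 + 1) ∈ μ j)

open Classical in
/-- The finite set of all strictly nested families of `m` sub-diagrams of `λ_{a,b}`. -/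
def strictlyNested (lam : YoungDiagram) (a b m : ℕ) : Finset (Fin m → Finset (ℕ × ℕ)) :=
  (Fintype.piFinset fun _ : Fin m => subdiagrams (subRegion lam a b)).filter
    fun μ => IsStrictlyNested lam a b m μ

end

/-!
The determinant is evaluated by the Lindström-Gessel-Viennot cancellation, carried out on regions
instead of paths. A path of the network from the left projection of column `B` to the right
projection of row `A` is the boundary line of the set `ν ⊆ λ_{A,B}` of boxes below it, which is
closed under moving South or East inside `λ` (`lowerParts`). Complementation turns such sets into
sub-diagrams of `λ_{A,B}`, so `p_{A,B}` is the sum of `∏_{c ∈ ν} x_c` over all of them, and the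
expanded determinant is a signed sum over a permutation `σ` and lower parts `ν_k` inside
`λ_{a+σ(k),b+k}` (`lineFamilies`).

To every line belongs the up-set `belowLine` of the whole quadrant below it. The line is thereby
prolonged by two rays and meets every diagonal in exactly one point, and two lines meet on a diagonal
exactly if their up-sets agree there (`AgreeAt`). If some lines of a family meet, take a contact on
the diagonal of smallest content and exchange the parts of the two regions after that diagonal. The
first contacts do not change, so this is a weight-preserving, sign-reversing involution
(`firstContacts_swapTails`, `sum_contact_eq_zero`). If no lines meet, then since a line moves by unit
steps from one diagonal to the next, two lines keep the order of their columns on every diagonal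
(`strictAt_of_forall_not_agreeAt`). Far to the North-East this order is the order of their rows, so
`σ = 1`, and `p_{a,b,m}` is the sum over `freeFamilies`, the families of lower parts without contact.
This sum visibly has non-negative coefficients.

The same strict order on every diagonal says that the complements of the `ν_k` are strictly nested,
and conversely (`isStrictlyNested_sdiff`, `sdiff_mem_freeFamilies`). On the side of paths, the weights
telescope to the product of the variables below the path (`pathWeight_mul_faceAbove`). Paths and lower
parts determine each other, as the vertices of a path are the first points of the region below it on
their diagonals (`mem_lineFront_of_mem`, `shadow_injective`, `exists_shadow_eq`). Finally, paths are
vertex-disjoint exactly if their prolonged lines do not meet: a contact on one of the added rays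
forces another one at the adjacent end of the path (`disjoint_iff_forall_not_agreeAt`).
-/

noncomputable section


/-! ### Boundary lines as up-sets of the quadrant -/

/-- The content of a lattice point, constant along diagonals. Every step of a path in the network
raises it by `1`. -/
def content (c : ℕ × ℕ) : ℤ := (c.2 : ℤ) - c.1

open Classical in
/-- The complements `λ_{A,B} \ μ` of the sub-diagrams `μ` of `λ_{A,B}`, described intrinsically:
the sets of boxes of `λ_{A,B}` that are closed under moving South or East inside `λ`. -/
def lowerParts (lam : YoungDiagram) (A B : ℕ) : Finset (Finset (ℕ × ℕ)) :=
  (subRegion lam A B).powerset.filter fun ν => ∀ c ∈ ν, ∀ d ∈ lam, c ≤ d → d ∈ ν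

/-- The part of the infinite quadrant South-East of `(A, B)` that lies weakly below the boundary
line with lower part `ν`. Its boundary is the path of `ν` prolonged by a vertical ray along column
line `B` and a horizontal ray along row line `A`, so that it meets every diagonal. -/
def belowLine (lam : YoungDiagram) (A B : ℕ) (ν : Finset (ℕ × ℕ)) : Set (ℕ × ℕ) :=
  {c | A ≤ c.1 ∧ B ≤ c.2 ∧ (c ∈ lam → c ∈ ν)}

variable {lam : YoungDiagram} {A B A' B' : ℕ} {ν ν' : Finset (ℕ × ℕ)} {h : ℤ}

theorem mem_subRegion {c : ℕ × ℕ} : c ∈ subRegion lam A B ↔ c ∈ lam ∧ A ≤ c.1 ∧ B ≤ c.2 := by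
  simp [subRegion]

theorem mem_of_le {c d : ℕ × ℕ} (hcd : c ≤ d) (hd : d ∈ lam) : c ∈ lam :=
  lam.isLowerSet hcd hd

theorem mem_lowerParts : ν ∈ lowerParts lam A B ↔
    ν ⊆ subRegion lam A B ∧ ∀ c ∈ ν, ∀ d ∈ lam, c ≤ d → d ∈ ν := by
  simp [lowerParts]

theorem mem_belowLine {c : ℕ × ℕ} :
    c ∈ belowLine lam A B ν ↔ A ≤ c.1 ∧ B ≤ c.2 ∧ (c ∈ lam → c ∈ ν) := Iff.rfl

theorem isUpperSet_belowLine (hν : ν ∈ lowerParts lam A B) :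
    IsUpperSet (belowLine lam A B ν) := by
  intro c d hcd hc
  exact ⟨hc.1.trans hcd.1, hc.2.1.trans hcd.2, fun hd =>
    (mem_lowerParts.1 hν).2 c (hc.2.2 (mem_of_le hcd hd)) d hd hcd⟩

theorem mem_lowerPart_iff (hν : ν ∈ lowerParts lam A B) {c : ℕ × ℕ} :
    c ∈ ν ↔ c ∈ lam ∧ c ∈ belowLine lam A B ν := by
  constructor
  · intro hc
    have := mem_subRegion.1 ((mem_lowerParts.1 hν).1 hc)
    exact ⟨this.1, this.2.1, this.2.2, fun _ => hc⟩
  · exact fun hc => hc.2.2.2 hc.1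

/-- Taking complements in `λ_{A,B}` identifies sub-diagrams with lower parts. -/
theorem sdiff_mem_lowerParts {μ : Finset (ℕ × ℕ)} (hμ : IsSubdiagram (subRegion lam A B) μ) :
    subRegion lam A B \ μ ∈ lowerParts lam A B := by
  refine mem_lowerParts.2 ⟨Finset.sdiff_subset, fun c hc d hd hcd => ?_⟩
  rw [Finset.mem_sdiff] at hc ⊢
  have hc1 := mem_subRegion.1 hc.1
  exact ⟨mem_subRegion.2 ⟨hd, hc1.2.1.trans hcd.1, hc1.2.2.trans hcd.2⟩,
    fun hdμ => hc.2 (hμ.2 d hdμ c hc.1 hcd.1 hcd.2)⟩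

theorem isSubdiagram_sdiff (hν : ∀ c ∈ ν, ∀ d ∈ lam, c ≤ d → d ∈ ν) :
    IsSubdiagram (subRegion lam A B) (subRegion lam A B \ ν) := by
  refine ⟨Finset.sdiff_subset, fun c hc d hd h1 h2 => ?_⟩
  rw [Finset.mem_sdiff] at hc ⊢
  exact ⟨hd, fun hdν => hc.2 (hν d hdν c (mem_subRegion.1 hc.1).1 ⟨h1, h2⟩)⟩

theorem bsPoly_eq_sum_lowerParts (lam : YoungDiagram) (A B : ℕ) :
    bsPoly lam A B = ∑ ν ∈ lowerParts lam A B, boxProd ν := by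
  classical
  refine Finset.sum_bij' (fun μ _ => subRegion lam A B \ μ) (fun ν _ => subRegion lam A B \ ν)
    ?_ ?_ ?_ ?_ ?_
  · intro μ hμ
    exact sdiff_mem_lowerParts (Finset.mem_filter.1 hμ).2
  · intro ν hν
    refine Finset.mem_filter.2 ⟨Finset.mem_powerset.2 Finset.sdiff_subset, ?_⟩
    exact isSubdiagram_sdiff (mem_lowerParts.1 hν).2
  · intro μ hμ
    exact Finset.sdiff_sdiff_eq_self (Finset.mem_powerset.1 (Finset.mem_filter.1 hμ).1)
  · intro ν hν
    exact Finset.sdiff_sdiff_eq_self (mem_lowerParts.1 hν).1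
  · intros; rfl

/-! ### Contact of two boundary lines -/

/-- `W` and `W'` have the same intersection with the diagonal of content `h`. For two regions below
boundary lines this says that the two lines pass through the same lattice point of that diagonal. -/
def AgreeAt (W W' : Set (ℕ × ℕ)) (h : ℤ) : Prop :=
  ∀ c, content c = h → (c ∈ W ↔ c ∈ W')

theorem AgreeAt.symm {W W' : Set (ℕ × ℕ)} (hW : AgreeAt W W' h) : AgreeAt W' W h :=
  fun c hc => (hW c hc).symm

/-- `W'` lies strictly below `W` on the diagonal of content `h`. -/
def StrictAt (W W' : Set (ℕ × ℕ)) (h : ℤ) : Prop :=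
  ∃ d, content d = h ∧ d ∈ W ∧ d ∉ W'

/-- Two lattice points of the same diagonal are comparable. -/
theorem le_or_le_of_content_eq {c d : ℕ × ℕ} (hcd : content c = content d) : c ≤ d ∨ d ≤ c := by
  simp only [content, Prod.le_def] at *
  omega

theorem StrictAt.trans {W W' W'' : Set (ℕ × ℕ)} (hW' : IsUpperSet W') (hW'' : IsUpperSet W'')
    (h1 : StrictAt W W' h) (h2 : StrictAt W' W'' h) : StrictAt W W'' h := by
  obtain ⟨d, hd, hdW, hdW'⟩ := h1
  obtain ⟨e, he, heW', heW''⟩ := h2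
  refine ⟨d, hd, hdW, fun hd'' => ?_⟩
  rcases le_or_le_of_content_eq (hd.trans he.symm) with hle | hle
  · exact heW'' (hW'' hle hd'')
  · exact hdW' (hW' hle heW')

/-- Boundary lines move by unit steps, so they cannot exchange their order without meeting. -/
theorem StrictAt.succ {W W' : Set (ℕ × ℕ)} (hW : IsUpperSet W) (hW' : IsUpperSet W')
    (hs : StrictAt W W' h) (hna : ¬ AgreeAt W W' (h + 1)) : StrictAt W W' (h + 1) := by
  obtain ⟨d, hd, hdW, hdW'⟩ := hs
  simp only [AgreeAt, not_forall] at hna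
  obtain ⟨c, hc, hcW⟩ := hna
  by_cases h1 : c ∈ W
  · exact ⟨c, hc, h1, fun h2 => hcW ⟨fun _ => h2, fun _ => h1⟩⟩
  · have h2 : c ∈ W' := by
      by_contra h2
      exact hcW ⟨fun h => absurd h h1, fun h => absurd h h2⟩
    have : d ≤ c ∨ c ≤ d := by
      simp only [content, Prod.le_def] at *
      omega
    rcases this with hle | hle
    · exact absurd (hW hle hdW) h1
    · exact absurd (hW' hle h2) hdW'

theorem lt_colLen {i j : ℕ} (hij : (i, j) ∈ lam) : i < lam.colLen j :=
  YoungDiagram.mem_iff_lt_colLen.1 hij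

theorem lt_rowLen {i j : ℕ} (hij : (i, j) ∈ lam) : j < lam.rowLen i :=
  YoungDiagram.mem_iff_lt_rowLen.1 hij

/-- Far to the South-West the order of two boundary lines is that of their column lines. -/
theorem strictAt_of_le (hAB : (A, B) ∈ lam) (hB : B < B') (hh : h ≤ -(lam.colLen 0 : ℤ)) :
    StrictAt (belowLine lam A B ν) (belowLine lam A' B' ν') h := by
  obtain ⟨n, rfl⟩ : ∃ n : ℕ, h = -(n : ℤ) := ⟨h.natAbs, by omega⟩
  have h1 := lt_colLen hAB
  have h2 := lam.colLen_anti 0 B (Nat.zero_le B)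
  refine ⟨(B + n, B), by simp [content], ⟨?_, le_rfl, fun hm => ?_⟩, fun hm => ?_⟩
  · simp only; omega
  · have := lt_colLen hm
    omega
  · have := hm.2.1
    simp only at this
    omega

/-- Far to the North-East the order of two boundary lines is that of their row lines. -/
theorem row_lt_of_strictAt (hAB' : (A', B') ∈ lam) (hh : (lam.rowLen 0 : ℤ) ≤ h)
    (hs : StrictAt (belowLine lam A B ν) (belowLine lam A' B' ν') h) : A < A' := by
  obtain ⟨d, hd, hdW, hdW'⟩ := hs
  by_contra hle
  have h1 := lt_rowLen hAB'
  have h2 := lam.rowLen_anti 0 A' (Nat.zero_le _)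
  have h3 := lam.rowLen_anti 0 d.1 (Nat.zero_le _)
  have h4 := hdW.1
  simp only [content] at hd
  refine hdW' ⟨by omega, by omega, fun hm => ?_⟩
  have := lt_rowLen (i := d.1) (j := d.2) hm
  omega

/-- Two boundary lines that never meet keep the order of their column lines throughout. -/
theorem strictAt_of_forall_not_agreeAt (hν : ν ∈ lowerParts lam A B)
    (hν' : ν' ∈ lowerParts lam A' B') (hAB : (A, B) ∈ lam) (hB : B < B')
    (hna : ∀ h, ¬ AgreeAt (belowLine lam A B ν) (belowLine lam A' B' ν') h) (h : ℤ) :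
    StrictAt (belowLine lam A B ν) (belowLine lam A' B' ν') h := by
  rcases le_total h (-(lam.colLen 0 : ℤ)) with hle | hle
  · exact strictAt_of_le hAB hB hle
  · induction h, hle using Int.leInduction with
    | base => exact strictAt_of_le hAB hB le_rfl
    | succ n _ ih =>
      exact ih.succ (isUpperSet_belowLine hν) (isUpperSet_belowLine hν') (hna _)

/-! ### Exchanging the tails of two boundary lines -/

/-- The lower part that follows `ν` up to the diagonal of content `h`, and `ν'` after it. -/
def splice (h : ℤ) (ν ν' : Finset (ℕ × ℕ)) : Finset (ℕ × ℕ) :=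
  ν.filter (fun c => content c ≤ h) ∪ ν'.filter (fun c => ¬ content c ≤ h)

theorem mem_splice {c : ℕ × ℕ} :
    c ∈ splice h ν ν' ↔ if content c ≤ h then c ∈ ν else c ∈ ν' := by
  by_cases hc : content c ≤ h <;> simp [splice, hc, not_lt.2, lt_of_not_ge]

theorem splice_splice (h : ℤ) (ν ν' : Finset (ℕ × ℕ)) :
    splice h (splice h ν ν') (splice h ν' ν) = ν := by
  ext c
  by_cases hc : content c ≤ h <;> simp only [mem_splice, hc, if_true, if_false]

theorem boxProd_splice (h : ℤ) (ν ν' : Finset (ℕ × ℕ)) :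
    boxProd (splice h ν ν') = boxProd (ν.filter fun c => content c ≤ h) *
      boxProd (ν'.filter fun c => ¬ content c ≤ h) := by
  refine Finset.prod_union (Finset.disjoint_left.2 fun c h1 h2 => ?_)
  exact (Finset.mem_filter.1 h2).2 (Finset.mem_filter.1 h1).2

/-- The row bound after splicing: up to the diagonal of contact, a point below the first line is
also below the row line of the second. -/
theorem row_le_of_agreeAt (hW : IsUpperSet (belowLine lam A B ν))
    (hag : AgreeAt (belowLine lam A B ν) (belowLine lam A' B' ν') h) {c : ℕ × ℕ}
    (hc : c ∈ belowLine lam A B ν) (hch : content c ≤ h) : A' ≤ c.1 := by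
  obtain ⟨n, hn⟩ : ∃ n : ℕ, h = content c + n := ⟨(h - content c).toNat, by omega⟩
  have h1 : (c.1, c.2 + n) ∈ belowLine lam A B ν :=
    hW (a := c) ⟨le_rfl, by simp⟩ hc
  exact ((hag _ (by simp [content, hn]; ring)).1 h1).1

theorem col_le_of_agreeAt (hW : IsUpperSet (belowLine lam A B ν))
    (hag : AgreeAt (belowLine lam A B ν) (belowLine lam A' B' ν') h) {c : ℕ × ℕ}
    (hc : c ∈ belowLine lam A B ν) (hch : h ≤ content c) : B' ≤ c.2 := by
  obtain ⟨n, hn⟩ : ∃ n : ℕ, h = content c - n := ⟨(content c - h).toNat, by omega⟩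
  have h1 : (c.1 + n, c.2) ∈ belowLine lam A B ν :=
    hW (a := c) ⟨by simp, le_rfl⟩ hc
  exact ((hag _ (by simp [content, hn]; ring)).1 h1).2.1

/-- Up to the diagonal of contact, the points outside `λ` that the spliced line must have below it
are already below the first line. -/
theorem row_le_of_notMem (hAB' : (A, B') ∈ lam)
    (hag : AgreeAt (belowLine lam A B ν) (belowLine lam A' B' ν') h) {c : ℕ × ℕ} (hc : c ∉ lam)
    (h1 : A' ≤ c.1) (hch : content c ≤ h) : A ≤ c.1 := by
  by_contra hlt
  obtain ⟨n, hn⟩ : ∃ n : ℕ, h = content c + n := ⟨(h - content c).toNat, by omega⟩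
  have hc' : (c.1, c.2 + n) ∉ lam :=
    fun hm => hc (mem_of_le (d := (c.1, c.2 + n)) ⟨le_rfl, by simp⟩ hm)
  have hB' : B' ≤ c.2 := by
    by_contra hB'
    exact hc (mem_of_le (d := (A, B')) ⟨by simp only; omega, by simp only; omega⟩ hAB')
  exact hlt ((hag (c.1, c.2 + n) (by simp [content, hn]; ring)).2
    ⟨h1, hB'.trans (Nat.le_add_right _ _), fun hm => absurd hm hc'⟩).1

theorem col_le_of_notMem (hA'B : (A', B) ∈ lam)
    (hag : AgreeAt (belowLine lam A B ν) (belowLine lam A' B' ν') h) {c : ℕ × ℕ} (hc : c ∉ lam)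
    (h1 : B' ≤ c.2) (hch : h ≤ content c) : B ≤ c.2 := by
  by_contra hlt
  obtain ⟨n, hn⟩ : ∃ n : ℕ, h = content c - n := ⟨(content c - h).toNat, by omega⟩
  have hc' : (c.1 + n, c.2) ∉ lam :=
    fun hm => hc (mem_of_le (d := (c.1 + n, c.2)) ⟨by simp, le_rfl⟩ hm)
  have hA' : A' ≤ c.1 := by
    by_contra hA'
    exact hc (mem_of_le (d := (A', B)) ⟨by simp only; omega, by simp only; omega⟩ hA'B)
  exact hlt ((hag (c.1 + n, c.2) (by simp [content, hn]; ring)).2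
    ⟨hA'.trans (Nat.le_add_right _ _), h1, fun hm => absurd hm hc'⟩).2.1

/-- Where two boundary lines meet, their tails can be exchanged: the new line keeps the column line
of the head and takes over the row line of the tail. -/
theorem mem_belowLine_splice (hν : ν ∈ lowerParts lam A B) (hν' : ν' ∈ lowerParts lam A' B')
    (hAB' : (A, B') ∈ lam)
    (hag : AgreeAt (belowLine lam A B ν) (belowLine lam A' B' ν') h) (c : ℕ × ℕ) :
    c ∈ belowLine lam A' B (splice h ν ν') ↔
      if content c ≤ h then c ∈ belowLine lam A B ν else c ∈ belowLine lam A' B' ν' := by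
  have hW := isUpperSet_belowLine hν
  have hW' := isUpperSet_belowLine hν'
  split_ifs with hc
  · simp only [mem_belowLine (ν := splice h ν ν'), mem_splice, hc, if_true]
    constructor
    · rintro ⟨h1, h2, h3⟩
      refine ⟨?_, h2, h3⟩
      by_cases hm : c ∈ lam
      · exact ((mem_lowerPart_iff hν).1 (h3 hm)).2.1
      · exact row_le_of_notMem hAB' hag hm h1 hc
    · exact fun hcW => ⟨row_le_of_agreeAt hW hag hcW hc, hcW.2.1, hcW.2.2⟩
  · simp only [mem_belowLine (ν := splice h ν ν'), mem_splice, hc, if_false]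
    constructor
    · rintro ⟨h1, h2, h3⟩
      refine ⟨h1, ?_, h3⟩
      by_cases hm : c ∈ lam
      · exact ((mem_lowerPart_iff hν').1 (h3 hm)).2.2.1
      · exact col_le_of_notMem hAB' hag.symm hm h2 (by omega)
    · exact fun hcW => ⟨hcW.1, col_le_of_agreeAt hW' hag.symm hcW (by omega), hcW.2.2⟩

theorem splice_mem_lowerParts (hν : ν ∈ lowerParts lam A B) (hν' : ν' ∈ lowerParts lam A' B')
    (hAB' : (A, B') ∈ lam)
    (hag : AgreeAt (belowLine lam A B ν) (belowLine lam A' B' ν') h) :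
    splice h ν ν' ∈ lowerParts lam A' B := by
  have hW := isUpperSet_belowLine hν
  have hW' := isUpperSet_belowLine hν'
  have key : ∀ c, c ∈ splice h ν ν' ↔ c ∈ lam ∧ c ∈ belowLine lam A' B (splice h ν ν') := by
    intro c
    rw [mem_belowLine_splice hν hν' hAB' hag, mem_splice]
    split_ifs
    · exact mem_lowerPart_iff hν
    · exact mem_lowerPart_iff hν'
  refine mem_lowerParts.2 ⟨fun c hc => ?_, fun c hc d hd hcd => ?_⟩
  · have := (key c).1 hc
    exact mem_subRegion.2 ⟨this.1, this.2.1, this.2.2.1⟩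
  · rw [key, mem_belowLine_splice hν hν' hAB' hag] at hc ⊢
    refine ⟨hd, ?_⟩
    have hc := hc.2
    split_ifs at hc ⊢ with h1 h2 h2
    · exact hW hcd hc
    -- A step across the diagonal of contact passes through a point where both lines agree.
    · obtain ⟨n, hn⟩ : ∃ n : ℕ, h = content d + n := ⟨(h - content d).toNat, by omega⟩
      simp only [content, Prod.le_def] at *
      refine hW (a := (c.1 + (content c - h).toNat, c.2)) ?_ ((hag _ ?_).2 (hW' (a := c) ?_ hc)) <;>
        simp only [content, Prod.le_def] <;> omega
    · simp only [content, Prod.le_def] at *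
      refine hW' (a := (c.1, c.2 + (h - content c).toNat)) ?_ ((hag _ ?_).1 (hW (a := c) ?_ hc)) <;>
        simp only [content, Prod.le_def] <;> omega
    · exact hW' hcd hc

/-! ### The Lindström-Gessel-Viennot cancellation -/

/-- A term of the expanded determinant: a permutation `σ`, and for every `k` a lower part whose
boundary line starts at the `k`-th column line and ends at the `σ k`-th row line. -/
abbrev LineFamily (m : ℕ) : Type := (_ : Equiv.Perm (Fin m)) × (Fin m → Finset (ℕ × ℕ))

variable {a b m : ℕ}

/-- The region below the `k`-th boundary line of a family. -/
def lineRegion (lam : YoungDiagram) (a b : ℕ) (x : LineFamily m) (k : Fin m) : Set (ℕ × ℕ) :=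
  belowLine lam (a + x.1 k) (b + k) (x.2 k)

/-- The terms of the expanded determinant. -/
def lineFamilies (lam : YoungDiagram) (a b m : ℕ) : Finset (LineFamily m) :=
  Finset.univ.sigma fun σ =>
    Fintype.piFinset fun k : Fin m => lowerParts lam (a + σ k) (b + k)

theorem mem_lineFamilies {x : LineFamily m} :
    x ∈ lineFamilies lam a b m ↔ ∀ k, x.2 k ∈ lowerParts lam (a + x.1 k) (b + k) := by
  simp [lineFamilies]

/-- The first contacts of a family of boundary lines: the pairs of lines that meet on the diagonal
of smallest possible content. -/
def firstContacts (lam : YoungDiagram) (a b : ℕ) (x : LineFamily m) :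
    Set (ℤ × Fin m × Fin m) :=
  {t | t.2.1 ≠ t.2.2 ∧ AgreeAt (lineRegion lam a b x t.2.1) (lineRegion lam a b x t.2.2) t.1 ∧
    ∀ h < t.1, ∀ i j, i ≠ j → ¬ AgreeAt (lineRegion lam a b x i) (lineRegion lam a b x j) h}

/-- No two boundary lines of the family meet. -/
def NoContact (lam : YoungDiagram) (a b : ℕ) (x : LineFamily m) : Prop :=
  ∀ i j, i ≠ j → ∀ h, ¬ AgreeAt (lineRegion lam a b x i) (lineRegion lam a b x j) h

theorem not_agreeAt_of_le (hsq : ∀ i j : Fin m, (a + i, b + j) ∈ lam) (x : LineFamily m)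
    (hh : h ≤ -(lam.colLen 0 : ℤ)) {i j : Fin m} (hij : i ≠ j) :
    ¬ AgreeAt (lineRegion lam a b x i) (lineRegion lam a b x j) h := by
  wlog hlt : i < j generalizing i j
  · exact fun hag => this hij.symm (lt_of_le_of_ne (not_lt.1 hlt) hij.symm) hag.symm
  intro hag
  obtain ⟨d, hd, h1, h2⟩ := strictAt_of_le (ν := x.2 i) (A' := a + x.1 j) (ν' := x.2 j)
    (hsq (x.1 i) i) (Nat.add_lt_add_left hlt b) hh
  exact h2 ((hag d hd).1 h1)

theorem firstContacts_nonempty (hsq : ∀ i j : Fin m, (a + i, b + j) ∈ lam) {x : LineFamily m}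
    (hx : ¬ NoContact lam a b x) : (firstContacts lam a b x).Nonempty := by
  simp only [NoContact, not_forall, not_not] at hx
  obtain ⟨i, j, hij, h, hag⟩ := hx
  obtain ⟨h₀, ⟨i₀, j₀, hij₀, hag₀⟩, hmin⟩ := Int.exists_least_of_bdd
    (P := fun h => ∃ i j, i ≠ j ∧ AgreeAt (lineRegion lam a b x i) (lineRegion lam a b x j) h)
    ⟨-(lam.colLen 0 : ℤ), fun z ⟨i, j, hij, hag⟩ => le_of_not_ge fun hle =>
      not_agreeAt_of_le hsq x hle hij hag⟩ ⟨h, i, j, hij, hag⟩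
  exact ⟨(h₀, i₀, j₀), hij₀, hag₀, fun h hlt i j hij hag =>
    absurd (hmin h ⟨i, j, hij, hag⟩) (not_le.2 hlt)⟩

/-- For `t = (h, i, j)`, exchange of the tails of the lines `i` and `j` after the diagonal of
content `h`. Every other line is spliced with itself, hence unchanged. -/
def swapTails (t : ℤ × Fin m × Fin m) (x : LineFamily m) : LineFamily m :=
  ⟨x.1 * Equiv.swap t.2.1 t.2.2,
    fun k => splice t.1 (x.2 k) (x.2 (Equiv.swap t.2.1 t.2.2 k))⟩

theorem swapTails_swapTails (t : ℤ × Fin m × Fin m) (x : LineFamily m) :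
    swapTails t (swapTails t x) = x := by
  obtain ⟨σ, ν⟩ := x
  simp only [swapTails, mul_assoc, Equiv.swap_mul_self, mul_one, Equiv.swap_apply_self,
    splice_splice]

theorem prod_boxProd_swapTails (t : ℤ × Fin m × Fin m) (x : LineFamily m) :
    ∏ k, boxProd ((swapTails t x).2 k) = ∏ k, boxProd (x.2 k) := by
  simp only [swapTails, boxProd_splice, Finset.prod_mul_distrib]
  rw [Equiv.prod_comp (Equiv.swap t.2.1 t.2.2)
    (fun k => boxProd ((x.2 k).filter fun c => ¬ content c ≤ t.1)), ← Finset.prod_mul_distrib]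
  exact Finset.prod_congr rfl fun k _ => Finset.prod_filter_mul_prod_filter_not _ _ _

theorem agreeAt_swap {x : LineFamily m} {t : ℤ × Fin m × Fin m}
    (ht : AgreeAt (lineRegion lam a b x t.2.1) (lineRegion lam a b x t.2.2) t.1) (k : Fin m) :
    AgreeAt (lineRegion lam a b x k) (lineRegion lam a b x (Equiv.swap t.2.1 t.2.2 k)) t.1 := by
  rw [Equiv.swap_apply_def]
  split_ifs with h1 h2
  · rwa [h1]
  · rw [h2]; exact ht.symm
  · exact fun _ _ => Iff.rfl

theorem swapTails_mem (hsq : ∀ i j : Fin m, (a + i, b + j) ∈ lam) {x : LineFamily m}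
    (hx : x ∈ lineFamilies lam a b m) {t : ℤ × Fin m × Fin m}
    (ht : AgreeAt (lineRegion lam a b x t.2.1) (lineRegion lam a b x t.2.2) t.1) :
    swapTails t x ∈ lineFamilies lam a b m :=
  mem_lineFamilies.2 fun k => splice_mem_lowerParts (mem_lineFamilies.1 hx k)
    (mem_lineFamilies.1 hx _) (hsq _ _) (agreeAt_swap ht k)

theorem mem_lineRegion_swapTails (hsq : ∀ i j : Fin m, (a + i, b + j) ∈ lam) {x : LineFamily m}
    (hx : x ∈ lineFamilies lam a b m) {t : ℤ × Fin m × Fin m}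
    (ht : AgreeAt (lineRegion lam a b x t.2.1) (lineRegion lam a b x t.2.2) t.1) (k : Fin m)
    {c : ℕ × ℕ} (hc : content c ≤ t.1) :
    c ∈ lineRegion lam a b (swapTails t x) k ↔ c ∈ lineRegion lam a b x k :=
  (mem_belowLine_splice (mem_lineFamilies.1 hx k)
    (mem_lineFamilies.1 hx _) (hsq _ _) (agreeAt_swap ht k) c).trans (by rw [if_pos hc]; rfl)

/-- Exchanging tails at a first contact does not change the set of first contacts, because the
lines are unchanged up to that diagonal. This makes the exchange an involution. -/
theorem firstContacts_swapTails (hsq : ∀ i j : Fin m, (a + i, b + j) ∈ lam) {x : LineFamily m}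
    (hx : x ∈ lineFamilies lam a b m) {t : ℤ × Fin m × Fin m} (ht : t ∈ firstContacts lam a b x) :
    firstContacts lam a b (swapTails t x) = firstContacts lam a b x := by
  have hagree : ∀ h ≤ t.1, ∀ i j,
      AgreeAt (lineRegion lam a b (swapTails t x) i) (lineRegion lam a b (swapTails t x) j) h ↔
        AgreeAt (lineRegion lam a b x i) (lineRegion lam a b x j) h := by
    refine fun h hh i j => forall_congr' fun c => forall_congr' fun hc => ?_
    rw [mem_lineRegion_swapTails hsq hx ht.2.1 i (hc.trans_le hh),
      mem_lineRegion_swapTails hsq hx ht.2.1 j (hc.trans_le hh)]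
  ext s
  constructor
  · rintro ⟨h1, h2, h3⟩
    have hs : s.1 ≤ t.1 := by
      by_contra hlt
      exact h3 _ (not_le.1 hlt) _ _ ht.1 ((hagree _ le_rfl _ _).2 ht.2.1)
    exact ⟨h1, (hagree _ hs _ _).1 h2, fun h hlt i j hij hag =>
      h3 h hlt i j hij ((hagree _ (hlt.le.trans hs) _ _).2 hag)⟩
  · rintro ⟨h1, h2, h3⟩
    have hs : s.1 ≤ t.1 := by
      by_contra hlt
      exact h3 _ (not_le.1 hlt) _ _ ht.1 ht.2.1
    exact ⟨h1, (hagree _ hs _ _).2 h2, fun h hlt i j hij hag =>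
      h3 h hlt i j hij ((hagree _ (hlt.le.trans hs) _ _).1 hag)⟩

/-- The signed weight of a term of the expanded determinant. -/
def signedWeight (x : LineFamily m) : MvPolynomial (ℕ × ℕ) ℤ :=
  Equiv.Perm.sign x.1 • ∏ k, boxProd (x.2 k)

theorem signedWeight_swapTails {t : ℤ × Fin m × Fin m} (ht : t.2.1 ≠ t.2.2) (x : LineFamily m) :
    signedWeight (swapTails t x) = -signedWeight x := by
  rw [signedWeight, prod_boxProd_swapTails]
  simp [signedWeight, swapTails, Equiv.Perm.sign_swap ht]

theorem pyramidPoly_eq_sum_lineFamilies (lam : YoungDiagram) (a b m : ℕ) :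
    pyramidPoly lam a b m = ∑ x ∈ lineFamilies lam a b m, signedWeight x := by
  simp only [pyramidPoly, Matrix.det_apply, Matrix.of_apply, bsPoly_eq_sum_lowerParts,
    Finset.prod_univ_sum, lineFamilies, Finset.sum_sigma, signedWeight, Finset.smul_sum]

open Classical in
/-- The terms in which two lines meet cancel. -/
theorem sum_contact_eq_zero (hsq : ∀ i j : Fin m, (a + i, b + j) ∈ lam) :
    ∑ x ∈ lineFamilies lam a b m with ¬ NoContact lam a b x, signedWeight x = 0 := by
  have hne : ∀ x ∈ (lineFamilies lam a b m).filter (fun x => ¬ NoContact lam a b x),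
      (firstContacts lam a b x).Nonempty := fun x hx =>
    firstContacts_nonempty hsq (Finset.mem_filter.1 hx).2
  -- The chosen contact depends on the family only through the set of its first contacts.
  have hsome : ∀ {s s' : Set (ℤ × Fin m × Fin m)} (hs : s.Nonempty) (hs' : s'.Nonempty),
      s = s' → hs.some = hs'.some := by
    rintro s s' hs hs' rfl
    rfl
  have hmem : ∀ x (hx : x ∈ (lineFamilies lam a b m).filter fun x => ¬ NoContact lam a b x),
      swapTails (hne x hx).some x ∈
        (lineFamilies lam a b m).filter fun x => ¬ NoContact lam a b x := by
    intro x hx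
    have ht := (hne x hx).some_mem
    have hx' := (Finset.mem_filter.1 hx).1
    refine Finset.mem_filter.2 ⟨swapTails_mem hsq hx' ht.2.1, fun hnc => ?_⟩
    have ht' : (hne x hx).some ∈ firstContacts lam a b (swapTails (hne x hx).some x) := by
      rw [firstContacts_swapTails hsq hx' ht]
      exact ht
    exact hnc _ _ ht'.1 _ ht'.2.1
  refine Finset.sum_involution (fun x hx => swapTails (hne x hx).some x) ?_ ?_ hmem ?_
  · intro x hx
    rw [signedWeight_swapTails (hne x hx).some_mem.1, add_neg_cancel]
  · intro x hx _ heq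
    have h1 : x.1 * Equiv.swap (hne x hx).some.2.1 (hne x hx).some.2.2 = x.1 :=
      congrArg Sigma.fst heq
    rw [mul_eq_left, Equiv.swap_eq_one_iff] at h1
    exact (hne x hx).some_mem.1 h1
  · intro x hx
    rw [hsome (hne _ (hmem x hx)) (hne x hx) (firstContacts_swapTails hsq
      (Finset.mem_filter.1 hx).1 (hne x hx).some_mem), swapTails_swapTails]

/-- A permutation whose boundary lines can be drawn without contact is the identity. -/
theorem NoContact.perm_eq_one (hsq : ∀ i j : Fin m, (a + i, b + j) ∈ lam) {x : LineFamily m}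
    (hx : x ∈ lineFamilies lam a b m) (hnc : NoContact lam a b x) : x.1 = 1 := by
  have hmono : StrictMono x.1 := by
    intro i j hij
    have := row_lt_of_strictAt (hsq (x.1 j) j) le_rfl (strictAt_of_forall_not_agreeAt
      (mem_lineFamilies.1 hx i) (mem_lineFamilies.1 hx j) (hsq _ _) (Nat.add_lt_add_left hij b)
      (hnc i j hij.ne) (lam.rowLen 0))
    simpa using this
  ext1 i
  exact congrArg (fun f : Fin m ≃o Fin m => f i)
    (Subsingleton.elim (hmono.orderIsoOfSurjective x.1 x.1.surjective) (OrderIso.refl _))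

open Classical in
/-- The families of lower parts, one inside each `λ_{a+k,b+k}`, whose boundary lines do not meet. -/
def freeFamilies (lam : YoungDiagram) (a b m : ℕ) : Finset (Fin m → Finset (ℕ × ℕ)) :=
  (Fintype.piFinset fun k : Fin m => lowerParts lam (a + k) (b + k)).filter fun ν =>
    NoContact lam a b ⟨1, ν⟩

theorem mem_freeFamilies {ν : Fin m → Finset (ℕ × ℕ)} :
    ν ∈ freeFamilies lam a b m ↔
      (∀ k : Fin m, ν k ∈ lowerParts lam (a + k) (b + k)) ∧ NoContact lam a b ⟨1, ν⟩ := by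
  simp [freeFamilies]

theorem pyramidPoly_eq_sum_freeFamilies (hsq : ∀ i j : Fin m, (a + i, b + j) ∈ lam) :
    pyramidPoly lam a b m = ∑ ν ∈ freeFamilies lam a b m, ∏ k, boxProd (ν k) := by
  classical
  rw [pyramidPoly_eq_sum_lineFamilies,
    ← Finset.sum_filter_add_sum_filter_not _ (NoContact lam a b), sum_contact_eq_zero hsq, add_zero]
  have hone : ∀ x ∈ (lineFamilies lam a b m).filter (NoContact lam a b), x = ⟨1, x.2⟩ := by
    intro x hx
    rw [Finset.mem_filter] at hx
    have h1 := hx.2.perm_eq_one hsq hx.1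
    obtain ⟨σ, ν⟩ := x
    dsimp only at h1
    rw [h1]
  refine Finset.sum_bij' (fun x _ => x.2) (fun ν _ => ⟨1, ν⟩) ?_ ?_ ?_ ?_ ?_
  · intro x hx
    rw [hone x hx, Finset.mem_filter, mem_lineFamilies] at hx
    exact mem_freeFamilies.2 hx
  · intro ν hν
    rw [mem_freeFamilies] at hν
    exact Finset.mem_filter.2 ⟨mem_lineFamilies.2 hν.1, hν.2⟩
  · exact fun x hx => (hone x hx).symm
  · intros; rfl
  · intro x hx
    rw [hone x hx]
    simp [signedWeight]

/-! ### Lines without contact and strictly nested partitions -/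

/-- The first points of `W` on the diagonals. For the region below a boundary line these are the
points of the (prolonged) line. -/
def lineFront (W : Set (ℕ × ℕ)) : Set (ℕ × ℕ) :=
  {w | w ∈ W ∧ ∀ d ∈ W, content d = content w → w ≤ d}

theorem exists_mem_lineFront (lam : YoungDiagram) (A B : ℕ) (ν : Finset (ℕ × ℕ)) (h : ℤ) :
    ∃ w ∈ lineFront (belowLine lam A B ν), content w = h := by
  classical
  have hex : ∃ n, ∃ w ∈ belowLine lam A B ν, content w = h ∧ w.1 = n := by
    have h0 := lam.rowLen_anti 0 (A + B + lam.colLen 0 + h.natAbs) (Nat.zero_le _)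
    refine ⟨_, (A + B + lam.colLen 0 + h.natAbs,
      (A + B + lam.colLen 0 + h.natAbs + h).toNat), ⟨?_, ?_, fun hm => ?_⟩, ?_, rfl⟩
    · simp only; omega
    · simp only; omega
    · have h1 := lt_colLen hm
      have h2 := lam.colLen_anti 0 (A + B + lam.colLen 0 + h.natAbs + h).toNat (Nat.zero_le _)
      omega
    · simp only [content]; omega
  obtain ⟨w, hw, hwh, hwn⟩ := Nat.find_spec hex
  refine ⟨w, ⟨hw, fun d hd hdw => ?_⟩, hwh⟩
  have := Nat.find_min' hex ⟨d, hd, hdw.trans hwh, rfl⟩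
  simp only [content, Prod.le_def] at *
  omega

theorem strictAt_of_mem_freeFamilies (hsq : ∀ i j : Fin m, (a + i, b + j) ∈ lam)
    {ν : Fin m → Finset (ℕ × ℕ)} (hν : ν ∈ freeFamilies lam a b m) {i j : Fin m} (hij : i < j)
    (h : ℤ) : StrictAt (belowLine lam (a + i) (b + i) (ν i)) (belowLine lam (a + j) (b + j) (ν j))
      h := by
  rw [mem_freeFamilies] at hν
  exact strictAt_of_forall_not_agreeAt (hν.1 i) (hν.1 j) (hsq _ _) (Nat.add_lt_add_left hij b)
    (hν.2 i j hij.ne) h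

theorem StrictAt.not_agreeAt {W W' : Set (ℕ × ℕ)} (hs : StrictAt W W' h) : ¬ AgreeAt W W' h := by
  obtain ⟨d, hd, h1, h2⟩ := hs
  exact fun hag => h2 ((hag d hd).1 h1)

theorem mem_freeFamilies_of_strictAt {ν : Fin m → Finset (ℕ × ℕ)}
    (hν : ∀ k : Fin m, ν k ∈ lowerParts lam (a + k) (b + k))
    (hs : ∀ i j : Fin m, (i : ℕ) + 1 = j → ∀ h,
      StrictAt (belowLine lam (a + i) (b + i) (ν i)) (belowLine lam (a + j) (b + j) (ν j)) h) :
    ν ∈ freeFamilies lam a b m := by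
  have hlt : ∀ (n : ℕ) (i j : Fin m), (i : ℕ) + n + 1 = j → ∀ h,
      StrictAt (belowLine lam (a + i) (b + i) (ν i)) (belowLine lam (a + j) (b + j) (ν j)) h := by
    intro n
    induction n with
    | zero => exact hs
    | succ n ih =>
      intro i j hij h
      have hk : (i : ℕ) + n + 1 < m := by omega
      exact (ih i ⟨i + n + 1, hk⟩ rfl h).trans (isUpperSet_belowLine (hν _))
        (isUpperSet_belowLine (hν j)) (hs ⟨i + n + 1, hk⟩ j (by simp only; omega) h)
  refine mem_freeFamilies.2 ⟨hν, fun i j hij h hag => ?_⟩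
  rcases lt_or_gt_of_ne hij with h1 | h1
  · exact (hlt (j - i - 1) i j (by omega) h).not_agreeAt hag
  · exact (hlt (i - j - 1) j i (by omega) h).not_agreeAt hag.symm

/-- Complements of the members of a family of lines without contact are strictly nested. -/
theorem isStrictlyNested_sdiff (hsq : ∀ i j : Fin m, (a + i, b + j) ∈ lam)
    {ν : Fin m → Finset (ℕ × ℕ)} (hν : ν ∈ freeFamilies lam a b m) :
    IsStrictlyNested lam a b m fun i => subRegion lam a b \ ν i := by
  have hν1 := (mem_freeFamilies.1 hν).1
  have hsub : ∀ i, ν i ⊆ subRegion lam a b := fun i c hc => by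
    have := mem_subRegion.1 ((mem_lowerParts.1 (hν1 i)).1 hc)
    exact mem_subRegion.2 ⟨this.1, by omega, by omega⟩
  refine ⟨fun i => isSubdiagram_sdiff (mem_lowerParts.1 (hν1 i)).2, fun i => ?_, fun i j hij => ?_⟩
  · rw [Finset.sdiff_sdiff_eq_self (hsub i)]
    exact (mem_lowerParts.1 (hν1 i)).1
  · rw [Finset.sdiff_sdiff_eq_self (hsub i), Finset.sdiff_sdiff_eq_self (hsub j)]
    have hs := strictAt_of_mem_freeFamilies hsq hν (i := i) (j := j) (by rw [Fin.lt_def]; omega)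
    have hW := isUpperSet_belowLine (hν1 i)
    have hW' := isUpperSet_belowLine (hν1 j)
    constructor
    · intro c hc
      have hc' := (mem_lowerPart_iff (hν1 j)).1 hc
      obtain ⟨d, hd, hdW, hdW'⟩ := hs (content c)
      refine (mem_lowerPart_iff (hν1 i)).2 ⟨hc'.1, ?_⟩
      rcases le_or_le_of_content_eq hd with hle | hle
      · exact hW hle hdW
      · exact absurd (hW' hle hc'.2) hdW'
    · intro c hc hcS
      have hcν := (Finset.mem_sdiff.1 hc).2
      have hcS := mem_subRegion.1 hcS
      obtain ⟨d, hd, hdW, hdW'⟩ := hs (content c)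
      have hcW : c ∉ belowLine lam (a + i) (b + i) (ν i) := fun h => hcν (h.2.2 hcS.1)
      have hdc : ¬ d ≤ c := fun hle => hcW (hW hle hdW)
      have hle : (c.1 + 1, c.2 + 1) ≤ d := by
        simp only [content, Prod.le_def] at *
        omega
      have hcW' : (c.1 + 1, c.2 + 1) ∉ belowLine lam (a + j) (b + j) (ν j) :=
        fun h => hdW' (hW' hle h)
      simp only [mem_belowLine, not_and, Classical.not_imp] at hcW'
      have h1 := hcW' (by omega) (by omega)
      exact Finset.mem_sdiff.2 ⟨mem_subRegion.2 ⟨h1.1, by simp only; omega, by simp only; omega⟩,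
        h1.2⟩

/-- The lower parts of strictly nested sub-diagrams have boundary lines without contact. -/
theorem sdiff_mem_freeFamilies {μ : Fin m → Finset (ℕ × ℕ)} (hμ : IsStrictlyNested lam a b m μ) :
    (fun i => subRegion lam a b \ μ i) ∈ freeFamilies lam a b m := by
  have hν : ∀ k : Fin m, subRegion lam a b \ μ k ∈ lowerParts lam (a + k) (b + k) := fun k =>
    mem_lowerParts.2 ⟨hμ.2.1 k, (mem_lowerParts.1 (sdiff_mem_lowerParts (hμ.1 k))).2⟩
  refine mem_freeFamilies_of_strictAt hν fun i j hij h => ?_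
  obtain ⟨w, ⟨hw, hmin⟩, hwh⟩ := exists_mem_lineFront lam (a + i) (b + i) (subRegion lam a b \ μ i) h
  refine ⟨w, hwh, hw, fun hw' => ?_⟩
  obtain ⟨⟨p, hp⟩, q, hq⟩ : (∃ p, w.1 = p + 1) ∧ ∃ q, w.2 = q + 1 :=
    ⟨⟨w.1 - 1, by have := hw'.1; omega⟩, w.2 - 1, by have := hw'.2.1; omega⟩
  have hw1 := hw'.1
  have hw2 := hw'.2.1
  -- The box just North-West of the first point `w` lies above the line of `μ i`.
  have hpq : (p, q) ∉ belowLine lam (a + i) (b + i) (subRegion lam a b \ μ i) := fun hm => by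
    have := (hmin _ hm (by simp only [content]; omega)).1
    simp only at this
    omega
  simp only [mem_belowLine, not_and, Classical.not_imp] at hpq
  have h1 := hpq (by omega) (by omega)
  have hS : (p, q) ∈ subRegion lam (a + i) (b + i) :=
    mem_subRegion.2 ⟨h1.1, by simp only; omega, by simp only; omega⟩
  have hS' : (p, q) ∈ subRegion lam a b :=
    mem_subRegion.2 ⟨h1.1, by simp only; omega, by simp only; omega⟩
  have hmem := (hμ.2.2 i j hij).2 (p, q) (by
    by_contra hn
    exact h1.2 (Finset.mem_sdiff.2 ⟨hS', hn⟩)) hS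
  have hww : w = (p + 1, q + 1) := Prod.ext hp hq
  rw [hww] at hw'
  have h2 := hw'.2.2 (mem_subRegion.1 ((hμ.1 j).1 hmem)).1
  exact (Finset.mem_sdiff.1 h2).2 hmem

theorem sum_freeFamilies_eq_sum_strictlyNested (hsq : ∀ i j : Fin m, (a + i, b + j) ∈ lam) :
    ∑ ν ∈ freeFamilies lam a b m, ∏ k, boxProd (ν k) =
      ∑ μ ∈ strictlyNested lam a b m, ∏ i : Fin m, boxProd (subRegion lam a b \ μ i) := by
  classical
  have hsub : ∀ ν ∈ freeFamilies lam a b m, ∀ i, ν i ⊆ subRegion lam a b := fun ν hν i c hc => by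
    have := mem_subRegion.1 ((mem_lowerParts.1 ((mem_freeFamilies.1 hν).1 i)).1 hc)
    exact mem_subRegion.2 ⟨this.1, by omega, by omega⟩
  refine Finset.sum_bij' (fun ν _ i => subRegion lam a b \ ν i)
    (fun μ _ i => subRegion lam a b \ μ i) ?_ ?_ ?_ ?_ ?_
  · intro ν hν
    have hn := isStrictlyNested_sdiff hsq hν
    refine Finset.mem_filter.2 ⟨Fintype.mem_piFinset.2 fun i => Finset.mem_filter.2 ⟨?_, hn.1 i⟩, hn⟩
    exact Finset.mem_powerset.2 (hn.1 i).1
  · intro μ hμ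
    exact sdiff_mem_freeFamilies (Finset.mem_filter.1 hμ).2
  · exact fun ν hν => funext fun i => Finset.sdiff_sdiff_eq_self (hsub ν hν i)
  · exact fun μ hμ => funext fun i =>
      Finset.sdiff_sdiff_eq_self ((Finset.mem_filter.1 hμ).2.1 i).1
  · exact fun ν hν => Finset.prod_congr rfl fun i _ => by
      rw [Finset.sdiff_sdiff_eq_self (hsub ν hν i)]

theorem coeff_pyramidPoly_nonneg (hsq : ∀ i j : Fin m, (a + i, b + j) ∈ lam)
    (d : (ℕ × ℕ) →₀ ℕ) : 0 ≤ (pyramidPoly lam a b m).coeff d := by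
  classical
  rw [pyramidPoly_eq_sum_freeFamilies hsq, MvPolynomial.coeff_sum]
  refine Finset.sum_nonneg fun ν _ => ?_
  have hmon : ∀ s : Finset (ℕ × ℕ), ∃ e, boxProd s = MvPolynomial.monomial e 1 := fun s =>
    ⟨∑ c ∈ s, Finsupp.single c 1, (MvPolynomial.monomial_sum_one s _).symm⟩
  choose e he using hmon
  simp only [he]
  rw [← MvPolynomial.monomial_sum_one, MvPolynomial.coeff_monomial]
  split_ifs <;> simp

theorem mem_iterate_removeFirst (lam : YoungDiagram) (n : ℕ) (c : ℕ × ℕ) :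
    c ∈ removeFirst^[n] lam ↔ (c.1 + n, c.2 + n) ∈ lam := by
  induction n generalizing c with
  | zero => rfl
  | succ n ih =>
    have h1 : ∀ (κ : YoungDiagram), c ∈ removeFirst κ ↔ c ∈ κ ∧ (c.1 + 1, c.2 + 1) ∈ κ := by
      intro κ
      rw [← YoungDiagram.mem_cells (μ := removeFirst κ)]
      exact Finset.mem_filter.trans (and_congr_left' (YoungDiagram.mem_cells c))
    rw [Function.iterate_succ_apply', h1, ih, ih]
    simp only [add_assoc, add_comm 1 n]
    exact ⟨fun h => h.2, fun h => ⟨mem_of_le ⟨by simp, by simp⟩ h, h⟩⟩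

/-- The `m × m` square with North-West corner in `λ^{(m)}` is contained in `λ`. -/
theorem square_mem (hab : (a, b) ∈ pyramidLayer lam m) (i j : Fin m) : (a + i, b + j) ∈ lam :=
  mem_of_le ⟨by simp only; omega, by simp only; omega⟩ ((mem_iterate_removeFirst _ _ _).1 hab)

/-! ### Weights of paths -/

variable {S : Finset (ℕ × ℕ)} {u v w : ℕ × ℕ} {l : List (ℕ × ℕ)}

theorem IsNetEdge.step (he : IsNetEdge S u v) :
    (v.1 + 1 = u.1 ∧ v.2 = u.2) ∨ (v.1 = u.1 ∧ v.2 = u.2 + 1) := by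
  obtain ⟨c, -, ⟨rfl, rfl⟩ | ⟨rfl, rfl⟩ | ⟨rfl, rfl⟩ | ⟨rfl, rfl⟩⟩ := he <;> simp

/-- The boxes of `λ` weakly South-East of a path. -/
def shadow (lam : YoungDiagram) (l : List (ℕ × ℕ)) : Finset (ℕ × ℕ) :=
  lam.cells.filter fun c => ∃ v ∈ l, v ≤ c

theorem mem_shadow {c : ℕ × ℕ} : c ∈ shadow lam l ↔ c ∈ lam ∧ ∃ v ∈ l, v ≤ c := by
  simp [shadow]

theorem boxProd_ne_zero (s : Finset (ℕ × ℕ)) : boxProd s ≠ 0 :=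
  Finset.prod_ne_zero_iff.2 fun c _ => MvPolynomial.X_ne_zero c

theorem thetaZ_ne_zero (lam : YoungDiagram) (c : ℕ × ℕ) : thetaZ lam c ≠ 0 :=
  Finset.prod_ne_zero_iff.2 fun _ _ => boxProd_ne_zero _

/-- Splitting off the first factor of `Z`. -/
theorem thetaZ_eq_mul (lam : YoungDiagram) (p q : ℕ) :
    thetaZ lam (p, q) = boxProd (subRegion lam p q) * thetaZ lam (p + 1, q + 1) := by
  classical
  by_cases hpq : (p, q) ∈ lam
  · have : lam.cells.filter (fun d => p ≤ d.1 ∧ q ≤ d.2 ∧ d.1 - p = d.2 - q) =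
        insert (p, q) (lam.cells.filter
          fun d => p + 1 ≤ d.1 ∧ q + 1 ≤ d.2 ∧ d.1 - (p + 1) = d.2 - (q + 1)) := by
      ext ⟨i, j⟩
      simp only [Finset.mem_filter, Finset.mem_insert, YoungDiagram.mem_cells, Prod.mk.injEq]
      constructor
      · rintro ⟨h1, h2⟩
        by_cases hi : i = p
        · exact Or.inl (by omega)
        · exact Or.inr ⟨h1, by omega⟩
      · rintro (⟨rfl, rfl⟩ | ⟨h1, h2⟩)
        · exact ⟨hpq, by omega⟩
        · exact ⟨h1, by omega⟩
    rw [thetaZ, this, Finset.prod_insert (by simp), thetaZ]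
  · have h1 : subRegion lam p q = ∅ := by
      ext d
      simp only [mem_subRegion, Finset.notMem_empty, iff_false]
      exact fun hd => hpq (mem_of_le (d := d) ⟨hd.2.1, hd.2.2⟩ hd.1)
    have h2 : ∀ s, (p, q) ≤ s → thetaZ lam s = 1 := by
      intro s hs
      refine Finset.prod_eq_one fun d hd => absurd ?_ hpq
      rw [Finset.mem_filter, YoungDiagram.mem_cells] at hd
      exact mem_of_le (hs.trans ⟨hd.2.1, hd.2.2.1⟩) hd.1
    rw [h2 _ le_rfl, h2 (p + 1, q + 1) ⟨by simp, by simp⟩, h1, boxProd, Finset.prod_empty, one_mul]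

theorem thetaZ_eq_one (hc : w ∉ lam) : thetaZ lam w = 1 := by
  refine Finset.prod_eq_one fun d hd => absurd ?_ hc
  rw [Finset.mem_filter, YoungDiagram.mem_cells] at hd
  exact mem_of_le (d := d) ⟨hd.2.1, hd.2.2.1⟩ hd.1

theorem shadow_singleton (lam : YoungDiagram) (v : ℕ × ℕ) :
    shadow lam [v] = subRegion lam v.1 v.2 := by
  ext c
  simp [mem_shadow, mem_subRegion, Prod.le_def]

theorem shadow_cons_north (huv : v.1 + 1 = u.1 ∧ v.2 = u.2) :
    shadow lam (u :: v :: l) = shadow lam (v :: l) := by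
  ext c
  simp only [mem_shadow, List.mem_cons, exists_eq_or_imp, Prod.le_def]
  constructor
  · rintro ⟨h1, h2 | h2⟩
    · exact ⟨h1, Or.inl (by omega)⟩
    · exact ⟨h1, h2⟩
  · rintro ⟨h1, h2⟩
    exact ⟨h1, Or.inr h2⟩

/-- Along a path rows weakly decrease, columns weakly increase and contents strictly increase. -/
theorem pairwise_of_isChain (hl : l.IsChain (IsNetEdge S)) :
    l.Pairwise fun p q => q.1 ≤ p.1 ∧ p.2 ≤ q.2 ∧ content p < content q := by
  have : IsTrans (ℕ × ℕ) fun p q => q.1 ≤ p.1 ∧ p.2 ≤ q.2 ∧ content p < content q :=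
    ⟨fun p q r h1 h2 => ⟨h2.1.trans h1.1, h1.2.1.trans h2.2.1, h1.2.2.trans h2.2.2⟩⟩
  refine (hl.imp fun p q hpq => ?_).pairwise
  have := hpq.step
  simp only [content]
  omega

theorem boxProd_shadow_cons_east (hl : (u :: v :: l).IsChain (IsNetEdge S))
    (huv : v.1 = u.1 ∧ v.2 = u.2 + 1) :
    boxProd (shadow lam (u :: v :: l)) * boxProd (subRegion lam v.1 v.2) =
      boxProd (shadow lam (v :: l)) * boxProd (subRegion lam u.1 u.2) := by
  classical
  have hcol : ∀ p ∈ v :: l, u.2 + 1 ≤ p.2 := by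
    intro p hp
    rcases List.mem_cons.1 hp with rfl | hp
    · exact huv.2.ge
    · have := (List.pairwise_cons.1 (List.pairwise_cons.1 (pairwise_of_isChain hl)).2).1 p hp
      omega
  have h1 : shadow lam (u :: v :: l) =
      shadow lam (v :: l) ∪ (subRegion lam u.1 u.2).filter fun c => c.2 = u.2 := by
    ext c
    simp only [Finset.mem_union, Finset.mem_filter, mem_subRegion, mem_shadow]
    constructor
    · rintro ⟨hc, w, hw, hwc⟩
      rcases List.mem_cons.1 hw with rfl | hw
      · by_cases h2 : c.2 = w.2
        · exact Or.inr ⟨⟨hc, hwc.1, hwc.2⟩, h2⟩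
        · have := hwc.1
          have := hwc.2
          exact Or.inl ⟨hc, v, List.mem_cons_self, ⟨by omega, by omega⟩⟩
      · exact Or.inl ⟨hc, w, hw, hwc⟩
    · rintro (⟨hc, w, hw, hwc⟩ | ⟨hc, -⟩)
      · exact ⟨hc, w, List.mem_cons_of_mem _ hw, hwc⟩
      · exact ⟨hc.1, u, List.mem_cons_self, hc.2⟩
  have h2 : subRegion lam u.1 u.2 = subRegion lam v.1 v.2 ∪
      (subRegion lam u.1 u.2).filter fun c => c.2 = u.2 := by
    ext c
    simp only [Finset.mem_union, Finset.mem_filter, mem_subRegion]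
    constructor
    · rintro ⟨hc, h3, h4⟩
      by_cases h5 : c.2 = u.2
      · exact Or.inr ⟨⟨hc, h3, h4⟩, h5⟩
      · exact Or.inl ⟨hc, by omega, by omega⟩
    · rintro (⟨hc, h3, h4⟩ | h3)
      · exact ⟨hc, by omega, by omega⟩
      · exact h3.1
  have hd1 : Disjoint (shadow lam (v :: l)) ((subRegion lam u.1 u.2).filter fun c => c.2 = u.2) := by
    refine Finset.disjoint_left.2 fun c hc hc' => ?_
    obtain ⟨-, w, hw, hwc⟩ := mem_shadow.1 hc
    have := hcol w hw
    have := hwc.2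
    have := (Finset.mem_filter.1 hc').2
    omega
  have hd2 : Disjoint (subRegion lam v.1 v.2)
      ((subRegion lam u.1 u.2).filter fun c => c.2 = u.2) := by
    refine Finset.disjoint_left.2 fun c hc hc' => ?_
    have := (mem_subRegion.1 hc).2.2
    have := (Finset.mem_filter.1 hc').2
    omega
  have e1 : boxProd (shadow lam (u :: v :: l)) = boxProd (shadow lam (v :: l)) *
      boxProd ((subRegion lam u.1 u.2).filter fun c => c.2 = u.2) := by
    rw [h1]; exact Finset.prod_union hd1
  have e2 : boxProd (subRegion lam u.1 u.2) = boxProd (subRegion lam v.1 v.2) *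
      boxProd ((subRegion lam u.1 u.2).filter fun c => c.2 = u.2) := by
    conv_lhs => rw [h2]
    exact Finset.prod_union hd2
  rw [e1, e2]
  ring

theorem pathWeight_cons (lam : YoungDiagram) (u v : ℕ × ℕ) (l : List (ℕ × ℕ)) :
    pathWeight lam (u :: v :: l) = edgeWeight lam u v * pathWeight lam (v :: l) := by
  simp [pathWeight]

/-- The weights telescope: along a path from `u` to `v` they multiply to the product of the
variables below the path, up to the factor `Z'(u) / Z(v)`. -/
theorem pathWeight_mul_faceAbove (l : List (ℕ × ℕ)) (u v : ℕ × ℕ)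
    (hl : (u :: l).IsChain (IsNetEdge S)) (hv : (u :: l).getLast? = some v) :
    pathWeight lam (u :: l) * faceAbove lam v =
      algebraMap _ BoxRatFun (boxProd (shadow lam (u :: l))) * faceBelow lam u := by
  have hZ : ∀ w, faceAbove lam w =
      algebraMap _ BoxRatFun (boxProd (subRegion lam w.1 w.2)) * faceBelow lam w := fun w => by
    rw [faceAbove, faceBelow, ← map_mul, ← thetaZ_eq_mul]
  have hinj := IsFractionRing.injective (MvPolynomial (ℕ × ℕ) ℤ) BoxRatFun
  have hne : ∀ p : MvPolynomial (ℕ × ℕ) ℤ, p ≠ 0 → algebraMap _ BoxRatFun p ≠ 0 := fun p hp =>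
    (map_ne_zero_iff _ hinj).2 hp
  induction l generalizing u with
  | nil =>
    obtain rfl : u = v := by simpa using hv
    rw [shadow_singleton, ← hZ]
    simp [pathWeight]
  | cons w l ih =>
    have hchain := List.isChain_cons_cons.1 hl
    have ih := ih w hchain.2 (by simpa using hv)
    have hBw : faceBelow lam w ≠ 0 := hne _ (thetaZ_ne_zero _ _)
    have hRw := hne _ (boxProd_ne_zero (subRegion lam w.1 w.2))
    rw [pathWeight_cons, mul_assoc, ih, edgeWeight]
    rcases hchain.1.step with hs | hs
    · rw [if_pos (by omega), shadow_cons_north hs]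
      field_simp
    · rw [if_neg (by omega), hZ u, hZ w]
      have hE := congrArg (algebraMap _ BoxRatFun) (boxProd_shadow_cons_east (lam := lam) hl hs)
      rw [map_mul, map_mul] at hE
      field_simp
      linear_combination -faceBelow lam u * hE

/-! ### Paths and their lower parts -/

theorem isNetPath_cons_iff : IsNetPath S u v l ↔
    ∃ t, l = u :: t ∧ (u :: t).IsChain (IsNetEdge S) ∧ (u :: t).getLast? = some v := by
  constructor
  · rintro ⟨h1, h2, h3⟩
    cases l with
    | nil => simp at h2
    | cons w t =>
      obtain rfl : w = u := by simpa using h2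
      exact ⟨t, rfl, h1, h3⟩
  · rintro ⟨t, rfl, h1, h3⟩
    exact ⟨h1, rfl, h3⟩

/-- A path from a left projection to a right projection is weighted by the boxes below it. -/
theorem pathWeight_eq (hl : IsNetPath S (lam.colLen B, B) (A, lam.rowLen A) l) :
    pathWeight lam l = algebraMap _ BoxRatFun (boxProd (shadow lam l)) := by
  obtain ⟨t, rfl, h1, h2⟩ := isNetPath_cons_iff.1 hl
  have hkey := pathWeight_mul_faceAbove (lam := lam) t _ _ h1 h2
  have hr : (A, lam.rowLen A) ∉ lam := fun hm => (lt_rowLen hm).false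
  have hc : (lam.colLen B + 1, B + 1) ∉ lam := fun hm =>
    (lt_colLen (mem_of_le (d := (lam.colLen B + 1, B + 1)) (c := (lam.colLen B, B))
      ⟨by simp, by simp⟩ hm)).false
  simpa [faceAbove, faceBelow, thetaZ_eq_one hr, thetaZ_eq_one hc] using hkey

/-- Every vertex of a path lies weakly between the end points. -/
theorem between_of_mem (hl : IsNetPath S u v l) (hw : w ∈ l) :
    w.1 ≤ u.1 ∧ u.2 ≤ w.2 ∧ v.1 ≤ w.1 ∧ w.2 ≤ v.2 ∧ content u ≤ content w ∧
      content w ≤ content v := by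
  obtain ⟨t, rfl, h1, h2⟩ := isNetPath_cons_iff.1 hl
  have hp := pairwise_of_isChain h1
  have hu : w.1 ≤ u.1 ∧ u.2 ≤ w.2 ∧ content u ≤ content w := by
    rcases List.mem_cons.1 hw with rfl | hw
    · exact ⟨le_rfl, le_rfl, le_rfl⟩
    · have := (List.pairwise_cons.1 hp).1 w hw
      exact ⟨this.1, this.2.1, this.2.2.le⟩
  have hv : v.1 ≤ w.1 ∧ w.2 ≤ v.2 ∧ content w ≤ content v := by
    obtain ⟨s, hs⟩ := List.getLast?_eq_some_iff.1 h2
    rw [hs] at hp hw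
    rcases List.mem_append.1 hw with hw | hw
    · have := (List.pairwise_append.1 hp).2.2 w hw v (by simp)
      exact ⟨this.1, this.2.1, this.2.2.le⟩
    · rw [List.mem_singleton.1 hw]
      exact ⟨le_rfl, le_rfl, le_rfl⟩
  exact ⟨hu.1, hu.2.1, hv.1, hv.2.1, hu.2.2, hv.2.2⟩

/-- A path visits every diagonal between its end points. -/
theorem exists_mem_content_eq (t : List (ℕ × ℕ)) (u v : ℕ × ℕ)
    (hl : (u :: t).IsChain (IsNetEdge S)) (hv : (u :: t).getLast? = some v)
    (h1 : content u ≤ h) (h2 : h ≤ content v) : ∃ w ∈ u :: t, content w = h := by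
  induction t generalizing u with
  | nil =>
    obtain rfl : u = v := by simpa using hv
    exact ⟨u, by simp, le_antisymm h1 h2⟩
  | cons w t ih =>
    have hchain := List.isChain_cons_cons.1 hl
    rcases h1.eq_or_lt with h1 | h1
    · exact ⟨u, List.mem_cons_self, h1⟩
    · have hstep := hchain.1.step
      obtain ⟨x, hx, hxh⟩ := ih w hchain.2 (by simpa using hv) (by
        simp only [content] at *
        omega)
      exact ⟨x, List.mem_cons_of_mem _ hx, hxh⟩

theorem IsNetPath.exists_mem_content_eq (hl : IsNetPath S u v l) (h1 : content u ≤ h)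
    (h2 : h ≤ content v) : ∃ w ∈ l, content w = h := by
  obtain ⟨t, rfl, h3, h4⟩ := isNetPath_cons_iff.1 hl
  exact _root_.exists_mem_content_eq t u v h3 h4 h1 h2

theorem eq_or_edge_of_mem (t : List (ℕ × ℕ)) (u : ℕ × ℕ) (hl : (u :: t).IsChain (IsNetEdge S))
    (hw : w ∈ u :: t) : w = u ∨ ∃ p, IsNetEdge S p w := by
  induction t generalizing u with
  | nil => exact Or.inl (by simpa using hw)
  | cons x t ih =>
    have hchain := List.isChain_cons_cons.1 hl
    rcases List.mem_cons.1 hw with hw | hw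
    · exact Or.inl hw
    · rcases ih x hchain.2 hw with rfl | h
      · exact Or.inr ⟨u, hchain.1⟩
      · exact Or.inr h

/-- The lower part of a path from a left to a right projection. -/
theorem shadow_mem_lowerParts (hl : IsNetPath S (lam.colLen B, B) (A, lam.rowLen A) l) :
    shadow lam l ∈ lowerParts lam A B := by
  refine mem_lowerParts.2 ⟨fun c hc => ?_, fun c hc d hd hcd => ?_⟩
  · obtain ⟨hc, w, hw, hwc⟩ := mem_shadow.1 hc
    have := between_of_mem hl hw
    exact mem_subRegion.2 ⟨hc, this.2.2.1.trans hwc.1, this.2.1.trans hwc.2⟩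
  · obtain ⟨hc, w, hw, hwc⟩ := mem_shadow.1 hc
    exact mem_shadow.2 ⟨hd, w, hw, hwc.trans hcd⟩

/-- No vertex of a path is strictly North-West of another one. -/
theorem not_northWest_of_mem (hl : l.IsChain (IsNetEdge S)) (hu : u ∈ l) (hv : v ∈ l) :
    ¬ (u.1 < v.1 ∧ u.2 < v.2) := by
  have hp := pairwise_of_isChain hl
  refine List.Pairwise.forall_of_forall_of_flip (R := fun p q : ℕ × ℕ => ¬ (p.1 < q.1 ∧ p.2 < q.2))
    (fun _ _ h => h.1.false) (hp.imp fun h1 h2 => ?_) (hp.imp fun h1 h2 => ?_) hu hv <;> omega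

/-- The vertices of a path are the first points, on their diagonals, of the region below it. -/
theorem mem_lineFront_of_mem
    (hl : IsNetPath (subRegion lam a b) (lam.colLen B, B) (A, lam.rowLen A) l) (hw : w ∈ l) :
    w ∈ lineFront (belowLine lam A B (shadow lam l)) := by
  have hb := between_of_mem hl hw
  refine ⟨⟨hb.2.2.1, hb.2.1, fun hm => mem_shadow.2 ⟨hm, w, hw, le_rfl⟩⟩, fun d hd hdw => ?_⟩
  by_contra hle
  have hlt : d.1 + 1 ≤ w.1 ∧ d.2 + 1 ≤ w.2 := by
    simp only [content, Prod.le_def] at *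
    omega
  obtain ⟨t, rfl, h1, h2⟩ := isNetPath_cons_iff.1 hl
  have hdlam : d ∈ lam := by
    rcases eq_or_edge_of_mem t _ h1 hw with rfl | ⟨p, c, hc, hp⟩
    · have h3 := hd.2.1
      simp only at hlt
      omega
    · refine mem_of_le (d := c) ?_ (mem_subRegion.1 hc).1
      simp only [Prod.le_def]
      rcases hp with ⟨-, rfl⟩ | ⟨-, rfl⟩ | ⟨-, rfl⟩ | ⟨-, rfl⟩ <;> simp only at hlt <;> omega
  obtain ⟨-, x, hx, hxd⟩ := mem_shadow.1 (hd.2.2 hdlam)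
  have hx1 := hxd.1
  have hx2 := hxd.2
  exact not_northWest_of_mem h1 hx hw ⟨by omega, by omega⟩

theorem eq_of_mem_lineFront {W : Set (ℕ × ℕ)} (hv : v ∈ lineFront W) (hw : w ∈ lineFront W)
    (hvw : content v = content w) : v = w :=
  le_antisymm (hv.2 w hw.1 hvw.symm) (hw.2 v hv.1 hvw)

/-- A path is determined by the boxes below it. -/
theorem shadow_injective {l' : List (ℕ × ℕ)}
    (hl : IsNetPath (subRegion lam a b) (lam.colLen B, B) (A, lam.rowLen A) l)
    (hl' : IsNetPath (subRegion lam a b) (lam.colLen B, B) (A, lam.rowLen A) l')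
    (heq : shadow lam l = shadow lam l') : l = l' := by
  have hsub : ∀ {l l' : List (ℕ × ℕ)},
      IsNetPath (subRegion lam a b) (lam.colLen B, B) (A, lam.rowLen A) l →
      IsNetPath (subRegion lam a b) (lam.colLen B, B) (A, lam.rowLen A) l' →
      shadow lam l = shadow lam l' → ∀ w ∈ l, w ∈ l' := by
    intro l l' hl hl' heq w hw
    have hb := between_of_mem hl hw
    obtain ⟨x, hx, hxw⟩ := hl'.exists_mem_content_eq hb.2.2.2.2.1 hb.2.2.2.2.2
    have h1 := mem_lineFront_of_mem hl hw
    have h2 := mem_lineFront_of_mem hl' hx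
    rw [← heq] at h2
    rwa [eq_of_mem_lineFront h1 h2 hxw.symm]
  have hp : ∀ {l : List (ℕ × ℕ)}, l.IsChain (IsNetEdge (subRegion lam a b)) →
      l.Pairwise fun p q => content p < content q :=
    fun hc => (pairwise_of_isChain hc).imp fun h => h.2.2
  have hnd : ∀ {l : List (ℕ × ℕ)}, l.IsChain (IsNetEdge (subRegion lam a b)) → l.Nodup :=
    fun hc => (hp hc).imp fun hlt he => (he ▸ hlt).false
  refine List.Perm.eq_of_pairwise (le := fun p q => content p < content q)
    (fun p q _ _ h1 h2 => absurd h1 h2.asymm) (hp hl.1) (hp hl'.1) ?_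
  exact (List.perm_ext_iff_of_nodup (hnd hl.1) (hnd hl'.1)).2 fun w =>
    ⟨hsub hl hl' heq w, hsub hl' hl heq.symm w⟩

theorem leftEnd_mem_lineFront (hAB : (A, B) ∈ lam) (ν : Finset (ℕ × ℕ)) :
    (lam.colLen B, B) ∈ lineFront (belowLine lam A B ν) := by
  refine ⟨⟨(lt_colLen hAB).le, le_rfl, fun hm => absurd (lt_colLen hm) (lt_irrefl _)⟩,
    fun d hd hdw => ?_⟩
  have h1 := hd.2.1
  simp only [content, Prod.le_def] at *
  omega

theorem rightEnd_mem_lineFront (hAB : (A, B) ∈ lam) (ν : Finset (ℕ × ℕ)) :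
    (A, lam.rowLen A) ∈ lineFront (belowLine lam A B ν) := by
  refine ⟨⟨le_rfl, (lt_rowLen hAB).le, fun hm => absurd (lt_rowLen hm) (lt_irrefl _)⟩,
    fun d hd hdw => ?_⟩
  have h1 := hd.1
  simp only [content, Prod.le_def] at *
  omega

/-- From every point of the boundary line between the two projections, the line continues inside
the network to the right projection: it steps North if that stays below the line, and East
otherwise. -/
theorem exists_isNetPath_from (hAB : (A, B) ∈ lam) (ha : a ≤ A) (hb : b ≤ B)
    (hν : ν ∈ lowerParts lam A B) (n : ℕ) (w : ℕ × ℕ)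
    (hw : w ∈ lineFront (belowLine lam A B ν)) (hle : w.1 ≤ lam.colLen B)
    (hn : content w + n = content (A, lam.rowLen A)) :
    ∃ l, IsNetPath (subRegion lam a b) w (A, lam.rowLen A) l ∧
      ∀ x ∈ l, x ∈ lineFront (belowLine lam A B ν) := by
  have hW := isUpperSet_belowLine hν
  induction n generalizing w with
  | zero =>
    obtain rfl := eq_of_mem_lineFront hw (rightEnd_mem_lineFront hAB ν) (by simpa using hn)
    exact ⟨[(A, lam.rowLen A)], ⟨by simp, rfl, rfl⟩, by simpa using hw⟩
  | succ n ih =>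
    suffices hstep : ∃ v, IsNetEdge (subRegion lam a b) w v ∧
        v ∈ lineFront (belowLine lam A B ν) ∧ v.1 ≤ w.1 by
      obtain ⟨v, he, hv, hvw⟩ := hstep
      have hs := he.step
      obtain ⟨l, hl, hlf⟩ := ih v hv (hvw.trans hle) (by
        simp only [content] at *
        omega)
      obtain ⟨t, rfl, h1, h2⟩ := isNetPath_cons_iff.1 hl
      refine ⟨w :: v :: t, ⟨List.isChain_cons_cons.2 ⟨he, h1⟩, rfl, by simpa using h2⟩, ?_⟩
      intro x hx
      rcases List.mem_cons.1 hx with rfl | hx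
      · exact hw
      · exact hlf x hx
    obtain ⟨p, q⟩ := w
    obtain ⟨⟨hpA, hqB, hpq⟩, hmin⟩ := hw
    simp only [content] at hle hn hpA hqB hmin
    -- Boxes above the line belong to `λ`, so they carry edges of the network.
    have hbox : ∀ i j, A ≤ i → B ≤ j → (i, j) ∉ belowLine lam A B ν →
        (i, j) ∈ subRegion lam a b := by
      intro i j hi hj hij
      simp only [mem_belowLine, not_and, Classical.not_imp] at hij
      exact mem_subRegion.2 ⟨(hij hi hj).1, ha.trans hi, hb.trans hj⟩
    by_cases hN : 1 ≤ p ∧ (p - 1, q) ∈ belowLine lam A B ν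
    · obtain ⟨p, rfl⟩ : ∃ k, p = k + 1 := ⟨p - 1, by omega⟩
      simp only [Nat.add_sub_cancel] at hN
      have hNA := hN.2.1
      simp only at hNA
      refine ⟨(p, q), ?_, ⟨hN.2, fun d hd hdc => ?_⟩, by simp⟩
      · by_cases hm : (p, q) ∈ lam
        · exact ⟨(p, q), mem_subRegion.2 ⟨hm, ha.trans hNA, hb.trans hqB⟩, Or.inl ⟨rfl, rfl⟩⟩
        · have hq : B < q := by
            refine lt_of_le_of_ne hqB fun hBq => hm ?_
            rw [← hBq]
            exact YoungDiagram.mem_iff_lt_colLen.2 (by omega)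
          obtain ⟨q, rfl⟩ : ∃ k, q = k + 1 := ⟨q - 1, by omega⟩
          refine ⟨(p, q), hbox _ _ hNA (by omega) fun hm' => ?_, Or.inr (Or.inl ⟨rfl, rfl⟩)⟩
          have := (hmin _ hm' (by simp)).1
          simp only at this
          omega
      · have := (hmin (d.1 + 1, d.2) (hW (a := d) ⟨by simp, le_rfl⟩ hd) (by
          simp only [content] at hdc ⊢
          omega))
        simp only [content, Prod.le_def] at *
        omega
    · refine ⟨(p, q + 1), ?_, ⟨hW (a := (p, q)) ⟨le_rfl, by simp⟩ ⟨hpA, hqB, hpq⟩,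
        fun d hd hdc => ?_⟩, le_rfl⟩
      · by_cases hm : (p, q) ∈ lam
        · exact ⟨(p, q), mem_subRegion.2 ⟨hm, ha.trans hpA, hb.trans hqB⟩,
            Or.inr (Or.inr (Or.inl ⟨rfl, rfl⟩))⟩
        · have hp : A < p := by
            refine lt_of_le_of_ne hpA fun hAp => hm ?_
            rw [← hAp]
            exact YoungDiagram.mem_iff_lt_rowLen.2 (by omega)
          obtain ⟨p, rfl⟩ : ∃ k, p = k + 1 := ⟨p - 1, by omega⟩
          simp only [Nat.add_sub_cancel, not_and] at hN
          exact ⟨(p, q), hbox _ _ (by omega) hqB (hN (by omega)),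
            Or.inr (Or.inr (Or.inr ⟨rfl, rfl⟩))⟩
      · by_contra hlt
        refine hN ?_
        simp only [content, Prod.le_def] at hdc hlt
        exact ⟨by omega, hW (a := d) ⟨by simp only; omega, by simp only; omega⟩ hd⟩

/-- Every lower part is the set of boxes below some path. -/
theorem exists_shadow_eq (hAB : (A, B) ∈ lam) (ha : a ≤ A) (hb : b ≤ B)
    (hν : ν ∈ lowerParts lam A B) :
    ∃ l, IsNetPath (subRegion lam a b) (lam.colLen B, B) (A, lam.rowLen A) l ∧
      shadow lam l = ν := by
  have hlen := lt_colLen hAB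
  have hlen' := lt_rowLen hAB
  obtain ⟨l, hl, hlf⟩ := exists_isNetPath_from hAB ha hb hν
    (content (A, lam.rowLen A) - content (lam.colLen B, B)).toNat _ (leftEnd_mem_lineFront hAB ν)
    le_rfl (by simp only [content]; omega)
  refine ⟨l, hl, ?_⟩
  ext c
  rw [mem_shadow, mem_lowerPart_iff hν]
  refine and_congr_right fun hc => ⟨fun ⟨x, hx, hxc⟩ =>
    isUpperSet_belowLine hν hxc (hlf x hx).1, fun hcW => ?_⟩
  have h1 := lt_colLen (i := c.1) (j := c.2) hc
  have h2 := lam.colLen_anti B c.2 hcW.2.1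
  have h3 := lt_rowLen (i := c.1) (j := c.2) hc
  have h4 := lam.rowLen_anti A c.1 hcW.1
  have h5 := hcW.1
  have h6 := hcW.2.1
  obtain ⟨x, hx, hxc⟩ := hl.exists_mem_content_eq (h := content c)
    (by simp only [content]; omega) (by simp only [content]; omega)
  exact ⟨x, hx, (hlf x hx).2 c hcW hxc.symm⟩

/-! ### Vertex-disjoint paths -/

theorem mem_iff_le_of_mem_lineFront {W : Set (ℕ × ℕ)} (hW : IsUpperSet W) (hw : w ∈ lineFront W)
    {c : ℕ × ℕ} (hc : content c = content w) : c ∈ W ↔ w ≤ c :=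
  ⟨fun h => hw.2 c h hc, fun h => hW h hw.1⟩

/-- A contact on the vertical ray below the left projection of the second line forces a contact at
that projection. -/
theorem leftEnd_mem_lineFront_of_agreeAt (hA : A ≤ A') (hB : B ≤ B')
    (hA'B' : (A', B') ∈ lam) (hν : ν ∈ lowerParts lam A B)
    (hag : AgreeAt (belowLine lam A B ν) (belowLine lam A' B' ν') h)
    (hh : h ≤ content (lam.colLen B', B')) :
    (lam.colLen B', B') ∈ lineFront (belowLine lam A B ν) := by
  have hlen := lt_colLen hA'B'
  refine ⟨⟨by simp only; omega, hB, fun hm => absurd (lt_colLen hm) (lt_irrefl _)⟩,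
    fun d hd hdw => ?_⟩
  obtain ⟨n, hn⟩ : ∃ n : ℕ, h = content d - n := ⟨(content d - h).toNat, by omega⟩
  have h1 := ((hag (d.1 + n, d.2) (by simp [content, hn]; ring)).1
    (isUpperSet_belowLine hν (a := d) ⟨by simp, le_rfl⟩ hd)).2.1
  simp only [content, Prod.le_def] at *
  omega

theorem rightEnd_mem_lineFront_of_agreeAt (hA : A ≤ A') (hB : B ≤ B')
    (hA'B' : (A', B') ∈ lam) (hν : ν ∈ lowerParts lam A B)
    (hag : AgreeAt (belowLine lam A B ν) (belowLine lam A' B' ν') h)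
    (hh : content (A', lam.rowLen A') ≤ h) :
    (A', lam.rowLen A') ∈ lineFront (belowLine lam A B ν) := by
  have hlen := lt_rowLen hA'B'
  refine ⟨⟨hA, by simp only; omega, fun hm => absurd (lt_rowLen hm) (lt_irrefl _)⟩,
    fun d hd hdw => ?_⟩
  obtain ⟨n, hn⟩ : ∃ n : ℕ, h = content d + n := ⟨(h - content d).toNat, by omega⟩
  have h1 := ((hag (d.1, d.2 + n) (by simp [content, hn]; ring)).1
    (isUpperSet_belowLine hν (a := d) ⟨le_rfl, by simp⟩ hd)).1
  simp only [content, Prod.le_def] at *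
  omega

/-- Two paths between left and right projections, the second from a column line further East to a
row line further South, are vertex-disjoint exactly if their prolonged boundary lines do not
meet. -/
theorem disjoint_iff_forall_not_agreeAt {l l' : List (ℕ × ℕ)} (hA : A ≤ A') (hB : B ≤ B')
    (hA'B' : (A', B') ∈ lam)
    (hl : IsNetPath (subRegion lam a b) (lam.colLen B, B) (A, lam.rowLen A) l)
    (hl' : IsNetPath (subRegion lam a b) (lam.colLen B', B') (A', lam.rowLen A') l') :
    l.Disjoint l' ↔ ∀ h, ¬ AgreeAt (belowLine lam A B (shadow lam l))
      (belowLine lam A' B' (shadow lam l')) h := by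
  have hW := isUpperSet_belowLine (shadow_mem_lowerParts hl)
  have hW' := isUpperSet_belowLine (shadow_mem_lowerParts hl')
  constructor
  · intro hdisj h hag
    have hmemS : ∀ e ∈ lineFront (belowLine lam A B (shadow lam l)), e ∈ l' → False := by
      intro e he hel'
      have h1 := between_of_mem hl' hel'
      have h2 := lam.colLen_anti B B' hB
      have h3 := lam.rowLen_anti A A' hA
      obtain ⟨x, hx, hxe⟩ := hl.exists_mem_content_eq (h := content e)
        (by simp only [content] at *; omega) (by simp only [content] at *; omega)
      rw [eq_of_mem_lineFront (mem_lineFront_of_mem hl hx) he hxe] at hx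
      exact hdisj hx hel'
    have hends : (lam.colLen B', B') ∈ l' ∧ (A', lam.rowLen A') ∈ l' :=
      ⟨List.mem_of_mem_head? hl'.2.1, List.mem_of_mem_getLast? hl'.2.2⟩
    rcases le_total h (content (lam.colLen B', B')) with hh | hh
    · exact hmemS _ (leftEnd_mem_lineFront_of_agreeAt hA hB hA'B' (shadow_mem_lowerParts hl)
        hag hh) hends.1
    rcases le_total (content (A', lam.rowLen A')) h with hh' | hh'
    · exact hmemS _ (rightEnd_mem_lineFront_of_agreeAt hA hB hA'B' (shadow_mem_lowerParts hl)
        hag hh') hends.2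
    obtain ⟨e, he, rfl⟩ := hl'.exists_mem_content_eq hh hh'
    have hef := mem_lineFront_of_mem hl' he
    exact hmemS e ⟨(hag e rfl).2 hef.1, fun d hd hde => hef.2 d ((hag d hde).1 hd) hde⟩ he
  · intro hna e he he'
    refine hna (content e) fun c hc => ?_
    rw [mem_iff_le_of_mem_lineFront hW (mem_lineFront_of_mem hl he) hc,
      mem_iff_le_of_mem_lineFront hW' (mem_lineFront_of_mem hl' he') hc]

/-- Vertex-disjoint families of paths correspond to families of lower parts without contact. -/
theorem nonIntersecting_iff (hsq : ∀ i j : Fin m, (a + i, b + j) ∈ lam)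
    {P : Fin m → List (ℕ × ℕ)} (hP : ∀ i : Fin m, IsNetPath (subRegion lam a b)
      (lam.colLen (b + i), b + i) (a + i, lam.rowLen (a + i)) (P i)) :
    P ∈ nonIntersecting lam a b m ↔ (fun i => shadow lam (P i)) ∈ freeFamilies lam a b m := by
  have hiff : ∀ i j : Fin m, i < j → ((P i).Disjoint (P j) ↔ ∀ h, ¬ AgreeAt
      (belowLine lam (a + i) (b + i) (shadow lam (P i)))
      (belowLine lam (a + j) (b + j) (shadow lam (P j))) h) := fun i j hij =>
    disjoint_iff_forall_not_agreeAt (Nat.add_le_add_left hij.le a) (Nat.add_le_add_left hij.le b)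
      (hsq _ _) (hP i) (hP j)
  rw [mem_freeFamilies]
  constructor
  · rintro ⟨-, hd⟩
    refine ⟨fun k => shadow_mem_lowerParts (hP k), fun i j hij h hag => ?_⟩
    rcases lt_or_gt_of_ne hij with hlt | hlt
    · exact (hiff i j hlt).1 (hd i j hij) h hag
    · exact (hiff j i hlt).1 (hd j i hij.symm) h hag.symm
  · rintro ⟨-, hnc⟩
    refine ⟨hP, fun i j hij => ?_⟩
    rcases lt_or_gt_of_ne hij with hlt | hlt
    · exact (hiff i j hlt).2 (hnc i j hij)
    · exact ((hiff j i hlt).2 (hnc j i hij.symm)).symm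

theorem sum_freeFamilies_eq_pathPartition (hsq : ∀ i j : Fin m, (a + i, b + j) ∈ lam) :
    algebraMap (MvPolynomial (ℕ × ℕ) ℤ) BoxRatFun
      (∑ ν ∈ freeFamilies lam a b m, ∏ k, boxProd (ν k)) = pathPartition lam a b m := by
  rw [map_sum, pathPartition]
  symm
  refine Finset.sum_bij (fun P _ i => shadow lam (P i)) ?_ ?_ ?_ ?_
  · intro P hP
    rw [Set.Finite.mem_toFinset] at hP
    exact (nonIntersecting_iff hsq hP.1).1 hP
  · intro P hP Q hQ heq
    rw [Set.Finite.mem_toFinset] at hP hQ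
    exact funext fun i => shadow_injective (hP.1 i) (hQ.1 i) (congrFun heq i)
  · intro ν hν
    choose P hP hPν using fun i : Fin m => exists_shadow_eq (hsq i i) (Nat.le_add_right a i)
      (Nat.le_add_right b i) ((mem_freeFamilies.1 hν).1 i)
    refine ⟨P, ?_, funext hPν⟩
    rw [Set.Finite.mem_toFinset]
    exact (nonIntersecting_iff hsq hP).2 (by rwa [funext hPν])
  · intro P hP
    rw [Set.Finite.mem_toFinset] at hP
    rw [map_prod]
    exact Finset.prod_congr rfl fun i _ => pathWeight_eq (hP.1 i)

end

theorem theorem7 (lam : YoungDiagram) (a b m : ℕ) (hm : 1 ≤ m)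
    (hab : (a, b) ∈ pyramidLayer lam m) :
    (∀ d : (ℕ × ℕ) →₀ ℕ, 0 ≤ (pyramidPoly lam a b m).coeff d) ∧
    algebraMap (MvPolynomial (ℕ × ℕ) ℤ) BoxRatFun (pyramidPoly lam a b m)
      = pathPartition lam a b m ∧
    pyramidPoly lam a b m
      = ∑ μ ∈ strictlyNested lam a b m, ∏ i : Fin m, boxProd (subRegion lam a b \ μ i) := by
  have hsq : ∀ i j : Fin m, (a + i, b + j) ∈ lam := square_mem hab
  refine ⟨coeff_pyramidPoly_nonneg hsq, ?_, ?_⟩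
  · rw [pyramidPoly_eq_sum_freeFamilies hsq, sum_freeFamilies_eq_pathPartition hsq]
  · rw [pyramidPoly_eq_sum_freeFamilies hsq, sum_freeFamilies_eq_sum_strictlyNested hsq]
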